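/- **Definitions.** Let $1<p<\infty$. For a real-valued martingale $f=(f_n)_{n\ge 0}$ on a probability space with filtration $(\mathcal F_n)_{n\ge 0}$ put $df_0=f_0$, $df_k=f_k-f_{k-1}$ for $k\ge 1$, and $\|f\|_p=\sup_{n\ge 0}\|f_n\|_p$. A sequence $v=(v_k)_{k\ge 0}$ is predictable if each $v_k$ is $\mathcal F_{(k-1)\vee 0}$-measurable, and the transform $v\ast f$ is given by $(v\ast f)_n=\sum_{k=0}^n v_k\,df_k$. For real $b\le B$ let $C_{p,b,B}$ be the least constant $C\ge 0$ such that $\|v\ast f\|_p\le C\|f\|_p$ for every real-valued martingale $f$ (on any filtered probability space) and every predictable $v$ with values in $[b,B]$. For a bounded measurable function $m:\mathbb R^d\setminus\{0\}\to\mathbb C$ let $T_m=\mathcal F^{-1}m\mathcal F$ on $L^2(\mathbb R^d)$, where $\mathcal F f(\xi)=\int_{\mathbb R^d}e^{-i\langle\xi,x\rangle}f(x)\,dx$. Let $\|T_m\|_p\in[0,\infty]$ be the least $C$ with $\|T_mf\|_p\le C\|f\|_p$ for all $f\in L^2(\mathbb R^d)\cap L^p(\mathbb R^d)$; this is the norm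 of $T_m$ on $L^p(\mathbb R^d)$, and it is $\infty$ if $T_m$ has no bounded extension to $L^p(\mathbb R^d)$. **Theorem.** Let $d\ge 2$ be an integer and let $m:\mathbb R^d\setminus\{0\}\to\mathbb R$ be bounded, continuous, even ($m(-\xi)=m(\xi)$) and homogeneous of order $0$ ($m(\lambda\xi)=m(\xi)$ for all $\lambda>0$). Let $b$ and $B$ be the minimum and the maximum of $m(e_1),\dots,m(e_d)$, where $e_1,\dots,e_d$ is the standard basis of $\mathbb R^d$. Then for every $1<p<\infty$ $$\|T_m\|_p\ \ge\ C_{p,b,B}.$$ More generally, for every $1<p<\infty$, $$\|T_m\|_p\ \ge\ \sup_{e}\,C_{p,b(e),B(e)},$$ where the supremum runs over all orthonormal bases $e=(e_j)_{j=1}^d$ of $\mathbb R^d$, and $b(e)$, $B(e)$ are the minimum and the maximum of $m(e_1),\dots,m(e_d)$. -/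

import Mathlib

open MeasureTheory
open scoped ENNReal FourierTransform

/-- The transform `v ∗ f` of a real sequence of random variables `f` by `v`:
`(v ∗ f)_n = ∑_{k ≤ n} v_k df_k`, where `df_0 = f_0` and `df_k = f_k - f_{k-1}` for `k ≥ 1`. -/
def mgTransform {Ω : Type*} (v f : ℕ → Ω → ℝ) (n : ℕ) (ω : Ω) : ℝ :=
  v 0 ω * f 0 ω + ∑ k ∈ Finset.range n, v (k + 1) ω * (f (k + 1) ω - f k ω)

/-- The norm `‖f‖_p = sup_n ‖f_n‖_p` of a sequence of real random variables. -/
noncomputable def mgNorm {Ω : Type*} [MeasurableSpace Ω] (P : Measure Ω) (p : ℝ≥0∞)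
    (f : ℕ → Ω → ℝ) : ℝ≥0∞ :=
  ⨆ n, eLpNorm (f n) p P

/-- `C` is admissible for `p, b, B` if `‖v ∗ f‖_p ≤ C ‖f‖_p` for every real-valued martingale `f`
(on any probability space with any discrete filtration `ℱ`) and every predictable sequence `v`
(`v_k` is measurable with respect to `ℱ_{(k-1) ∨ 0}`; the subtraction below is the truncated one)
with values in `[b, B]`. -/
def IsTransformBound (p : ℝ≥0∞) (b B : ℝ) (C : ℝ≥0∞) : Prop :=
  ∀ (Ω : Type) (mΩ : MeasurableSpace Ω) (P : Measure Ω), IsProbabilityMeasure P →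
    ∀ (ℱ : Filtration ℕ mΩ) (f v : ℕ → Ω → ℝ), Martingale f ℱ P →
      (∀ k, Measurable[ℱ (k - 1)] (v k)) → (∀ k ω, v k ω ∈ Set.Icc b B) →
      mgNorm P p (mgTransform v f) ≤ C * mgNorm P p f

/-- The constant `C_{p,b,B}`: the least constant in the `L^p` inequality for transforms of real
martingales by predictable sequences with values in `[b, B]`. -/
noncomputable def transformConst (p : ℝ≥0∞) (b B : ℝ) : ℝ≥0∞ :=
  sInf {C : ℝ≥0∞ | IsTransformBound p b B C}

/-- A Fourier multiplier: a bounded (measurable) complex function on `ℝ^d \ {0}`; the value that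
`m` takes at the origin plays no role. -/
structure IsFourierMultiplier {d : ℕ} (m : EuclideanSpace ℝ (Fin d) → ℂ) : Prop where
  measurable : Measurable m
  bounded : ∃ K : ℝ, ∀ ξ, ξ ≠ 0 → ‖m ξ‖ ≤ K

theorem IsFourierMultiplier.memLp {d : ℕ} {m : EuclideanSpace ℝ (Fin d) → ℂ}
    (hm : IsFourierMultiplier m) :
    MemLp (fun ξ => m ((2 * Real.pi) • ξ)) ∞ (volume : Measure (EuclideanSpace ℝ (Fin d))) := by
  obtain ⟨K, hK⟩ := hm.bounded
  refine memLp_top_of_bound (C := max K ‖m 0‖)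
    (hm.measurable.comp (measurable_const_smul _)).aestronglyMeasurable
    (Filter.Eventually.of_forall fun ξ => ?_)
  by_cases h : (2 * Real.pi) • ξ = 0
  · rw [h]; exact le_max_right _ _
  · exact (hK _ h).trans (le_max_left _ _)

/-- The operator `T_m = ℱ⁻¹ m ℱ` on `L²(ℝ^d; ℂ)`, for the Fourier transform
`ℱf(ξ) = ∫ e^{-i⟨ξ,x⟩} f(x) dx`. Mathlib's `𝓕` has the kernel `e^{-2πi⟨ξ,x⟩}`, that is
`𝓕 f ξ = ℱf(2πξ)`, so in terms of `𝓕` the symbol is `ξ ↦ m(2πξ)`. -/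
noncomputable def multiplierOp {d : ℕ} (m : EuclideanSpace ℝ (Fin d) → ℂ)
    (hm : IsFourierMultiplier m) (f : Lp ℂ 2 (volume : Measure (EuclideanSpace ℝ (Fin d)))) :
    Lp ℂ 2 (volume : Measure (EuclideanSpace ℝ (Fin d))) :=
  𝓕⁻ (hm.memLp.toLp • 𝓕 f : Lp ℂ 2 (volume : Measure (EuclideanSpace ℝ (Fin d))))

/-- `‖T_m : L^p(ℝ^d) → L^p(ℝ^d)‖`: the least `C` with `‖T_m f‖_p ≤ C ‖f‖_p` for all `f` in the
dense subspace `L² ∩ L^p`; it is `∞` if `T_m` has no bounded extension to `L^p`. -/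
noncomputable def multiplierNorm {d : ℕ} (p : ℝ≥0∞) (m : EuclideanSpace ℝ (Fin d) → ℂ)
    (hm : IsFourierMultiplier m) : ℝ≥0∞ :=
  sInf {C : ℝ≥0∞ | ∀ f : Lp ℂ 2 (volume : Measure (EuclideanSpace ℝ (Fin d))),
    MemLp f p volume → eLpNorm (multiplierOp m hm f) p volume ≤ C * eLpNorm f p volume}

open Filter Topology UnitAddTorus
open scoped SchwartzMap

/-! ### Trigonometric polynomials on the torus -/

/-! Fix an orthonormal basis `e`, let C be an L^p bound for T_m, and put σ(n) = m(∑ n_j e_j) for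
nonzero n in ℤ^d. Testing T_m on a fixed Schwartz function times a trigonometric polynomial dilated
by N → ∞ transfers the bound to the torus: if φ is a trigonometric polynomial without constant term
and ψ is its image under σ, then ‖ψ‖_p ≤ C‖φ‖_p (`integral_rpow_symbolPairs_le`).

For C' > C let U(z) be the supremum of ∫ V(z + (φ, ψ)) over all such pairs, where V(x, y) = |y|^p -
C'^p |x|^p. Then U is even, majorizes V, and is O(|z|^p) thanks to the gap between C and C'
(`exists_bellmanMean_le`). The core is midpoint concavity of U in each direction (1, σ(n))
(`bellmanMean_add_bellmanMean_le`). Since m is even and homogeneous, a mean-zero function r(⟨n, t⟩)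
is an eigenfunction with eigenvalue σ(n). With r almost a random sign, s r(⟨n, t⟩)(1, σ(n)) moves z
to z ± s(1, σ(n)), each on about half of the torus. On these halves one pastes in pairs chosen for
the two endpoints, sped up by a large factor N. Continuity and homogeneity of m make the slow
cut-offs harmless (`eventually_exists_symbolPairs_near`), and the averages decouple
(`tendsto_integral_mul_nsmul`).

Lower semicontinuity turns midpoint concavity into concavity and extends it to all directions (1, c)
with c in the closure of the values of σ. By the intermediate value theorem this closure contains
[b(e), B(e)] (`mem_closure_symbol`).

Burkholder's method finishes the proof: U(f_k, (v ∗ f)_k) decreases in mean and starts from values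
U(x, cx) ≤ 0, so the mean of V(f_n, (v ∗ f)_n) is at most 0 and C' is a transform bound. Finally C'
tends to C. -/

instance UnitAddCircle.isProbabilityMeasure_volume :
    IsProbabilityMeasure (volume : Measure UnitAddCircle) :=
  ⟨UnitAddCircle.measure_univ⟩

instance UnitAddTorus.isProbabilityMeasure_volume {ι : Type*} [Fintype ι] :
    IsProbabilityMeasure (volume : Measure (UnitAddTorus ι)) := by
  unfold UnitAddTorus
  infer_instance

section Torus

variable {ι : Type*} [Fintype ι]

theorem UnitAddTorus.integrable_of_continuous {F : Type*} [NormedAddCommGroup F]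
    {f : UnitAddTorus ι → F} (hf : Continuous f) : Integrable f := by
  refine (integrableOn_univ).1 ?_
  exact hf.continuousOn.integrableOn_compact isCompact_univ

theorem norm_mFourier_apply (n : ι → ℤ) (x : UnitAddTorus ι) : ‖mFourier n x‖ = 1 := by
  simp [mFourier, fourier_apply, Circle.norm_coe]

theorem mFourier_nsmul (n : ι → ℤ) (N : ℕ) (x : UnitAddTorus ι) :
    mFourier n (N • x) = mFourier ((N : ℤ) • n) x := by
  simp only [mFourier, ContinuousMap.coe_mk, Pi.smul_apply]
  refine Finset.prod_congr rfl fun i _ => ?_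
  simp only [fourier_apply, smul_eq_mul]
  rw [mul_comm, mul_smul, natCast_zsmul]

/-- The continuous homomorphism `x ↦ ∑ n_i x_i` from the torus to the circle. -/
noncomputable def torusChar (n : ι → ℤ) : UnitAddTorus ι →+ UnitAddCircle where
  toFun x := ∑ i, n i • x i
  map_zero' := by simp
  map_add' x y := by simp [smul_add, Finset.sum_add_distrib]

theorem torusChar_apply (n : ι → ℤ) (x : UnitAddTorus ι) :
    torusChar n x = ∑ i, n i • x i := rfl

theorem continuous_torusChar (n : ι → ℤ) : Continuous (torusChar n) := by
  change Continuous fun x : UnitAddTorus ι => ∑ i, n i • x i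
  fun_prop

theorem fourier_torusChar (n : ι → ℤ) (j : ℤ) (x : UnitAddTorus ι) :
    fourier j (torusChar n x) = mFourier (j • n) x := by
  classical
  have h : ∀ s : Finset ι, fourier j (∑ i ∈ s, n i • x i) = ∏ i ∈ s, fourier ((j • n) i) (x i) := by
    intro s
    induction s using Finset.induction_on with
    | empty => simp
    | insert a s ha ih =>
      rw [Finset.sum_insert ha, Finset.prod_insert ha, ← ih]
      simp [fourier_apply, smul_add, AddCircle.toCircle_add, mul_smul]
  exact h _

/-- A continuous surjective homomorphism of compact groups carries Haar measure to Haar measure.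
Surjectivity already holds on a coordinate with n_i ≠ 0, where one divides by n_i. -/
theorem measurePreserving_torusChar {n : ι → ℤ} (hn : n ≠ 0) :
    MeasurePreserving (torusChar n) volume volume := by
  classical
  refine AddMonoidHom.measurePreserving (continuous_torusChar n) ?_ (by simp)
  obtain ⟨i, hi⟩ := Function.ne_iff.1 hn
  intro y
  obtain ⟨t, rfl⟩ := QuotientAddGroup.mk_surjective y
  refine ⟨Pi.single i ((t / n i : ℝ) : UnitAddCircle), ?_⟩
  rw [torusChar_apply, Finset.sum_eq_single i]
  · rw [Pi.single_eq_same, ← AddCircle.coe_zsmul, zsmul_eq_mul,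
      mul_div_cancel₀ _ (by exact_mod_cast hi)]
  · intro j _ hj
    rw [Pi.single_eq_of_ne hj, smul_zero]
  · simp

theorem eventually_add_zsmul_ne_zero {ι : Type*} {n : ι → ℤ} (hn : n ≠ 0) (k : ι → ℤ) :
    ∀ᶠ N : ℕ in atTop, k + (N : ℤ) • n ≠ 0 := by
  obtain ⟨i, hi⟩ := Function.ne_iff.1 hn
  filter_upwards [eventually_gt_atTop (k i).natAbs] with N hN
  intro h0
  have h3 := congrFun h0 i
  simp only [Pi.add_apply, Pi.smul_apply, smul_eq_mul, Pi.zero_apply] at h3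
  have h4 : (k i).natAbs = N * (n i).natAbs := by
    have : k i = -(N * n i) := by linarith
    rw [this, Int.natAbs_neg, Int.natAbs_mul, Int.natAbs_natCast]
  have h5 : 1 ≤ (n i).natAbs := Int.natAbs_pos.2 hi
  nlinarith

/-- Translation by 1/(2j) preserves the integral and changes the sign of the character. -/
theorem integral_fourier_eq_zero {j : ℤ} (hj : j ≠ 0) :
    ∫ x : UnitAddCircle, fourier j x = 0 := by
  have h := integral_add_right_eq_self (μ := (volume : Measure UnitAddCircle))
    (fun x => (fourier j x : ℂ)) ((1 / 2 / j : ℝ) : UnitAddCircle)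
  have h2 : ∀ x : UnitAddCircle,
      (fourier j (x + ((1 / 2 / j : ℝ) : UnitAddCircle)) : ℂ) = -fourier j x := by
    intro x
    have := fourier_add_half_inv_index hj (T := 1) one_pos x
    rw [← this]
  simp_rw [h2] at h
  rw [integral_neg] at h
  have : (2 : ℂ) * ∫ x : UnitAddCircle, fourier j x = 0 := by
    linear_combination -h
  simpa using this

theorem integral_mFourier_eq_zero {n : ι → ℤ} (hn : n ≠ 0) :
    ∫ x : UnitAddTorus ι, mFourier n x = 0 := by
  have : ∀ x : UnitAddTorus ι, mFourier n x = fourier 1 (torusChar n x) := fun x => by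
    rw [fourier_torusChar, one_smul]
  simp_rw [this]
  rw [← integral_fourier_eq_zero (j := 1) one_ne_zero, ← (measurePreserving_torusChar hn).map_eq,
    integral_map (measurePreserving_torusChar hn).measurable.aemeasurable]
  exact (map_continuous (fourier 1)).aestronglyMeasurable

theorem UnitAddTorus.exists_span_mFourier_norm_sub_le (f : C(UnitAddTorus ι, ℂ)) {ε : ℝ}
    (hε : 0 < ε) :
    ∃ g ∈ Submodule.span ℂ (Set.range (mFourier (d := ι))), ‖f - g‖ ≤ ε := by
  have h : f ∈ (Submodule.span ℂ (Set.range (mFourier (d := ι)))).topologicalClosure := by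
    rw [span_mFourier_closure_eq_top]; trivial
  obtain ⟨g, hg, hfg⟩ := Metric.mem_closure_iff.1 h ε hε
  exact ⟨g, hg, by rw [← dist_eq_norm]; exact hfg.le⟩

theorem UnitAddCircle.exists_span_fourier_norm_sub_le (f : C(UnitAddCircle, ℂ)) {ε : ℝ}
    (hε : 0 < ε) :
    ∃ g ∈ Submodule.span ℂ (Set.range (fourier (T := (1 : ℝ)))), ‖f - g‖ ≤ ε := by
  have h : f ∈ (Submodule.span ℂ (Set.range (fourier (T := (1 : ℝ))))).topologicalClosure := by
    rw [span_fourier_closure_eq_top]; trivial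
  obtain ⟨g, hg, hfg⟩ := Metric.mem_closure_iff.1 h ε hε
  exact ⟨g, hg, by rw [← dist_eq_norm]; exact hfg.le⟩

/-! ### Decoupling of slow and fast oscillations, and approximate signs -/

/-- Averages against highly oscillating functions. If `Λ_N` are functionals on the continuous
functions on the torus which are uniformly bounded and converge on the characters to the mean value
times `c`, then they converge on all continuous functions. -/
theorem tendsto_of_tendsto_mFourier {l : Filter ℕ} (Λ : ℕ → C(UnitAddTorus ι, ℂ) →ₗ[ℂ] ℂ) (K : ℝ)
    (hK : ∀ N f, ‖Λ N f‖ ≤ K * ‖f‖) (c : ℂ)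
    (h : ∀ n, Tendsto (fun N => Λ N (mFourier n)) l (𝓝 (c * ∫ x, mFourier n x)))
    (f : C(UnitAddTorus ι, ℂ)) : Tendsto (fun N => Λ N f) l (𝓝 (c * ∫ x, f x)) := by
  have hspan : ∀ g ∈ Submodule.span ℂ (Set.range (mFourier (d := ι))),
      Tendsto (fun N => Λ N g) l (𝓝 (c * ∫ x, g x)) := by
    intro g hg
    induction hg using Submodule.span_induction with
    | mem g hg => obtain ⟨n, rfl⟩ := hg; exact h n
    | zero => simpa using tendsto_const_nhds
    | add f g _ _ hf hg =>
      have : ∫ x, (f + g) x = (∫ x, f x) + ∫ x, g x :=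
        integral_add (integrable_of_continuous f.continuous) (integrable_of_continuous g.continuous)
      rw [this, mul_add]
      simpa using hf.add hg
    | smul a f _ hf =>
      have : ∫ x, (a • f) x = a * ∫ x, f x := integral_const_mul a f
      rw [this, mul_left_comm]
      simpa using hf.const_mul a
  rw [Metric.tendsto_nhds]
  intro ε hε
  have hK0 : 0 < |K| + ‖c‖ + 1 := by positivity
  obtain ⟨g, hg, hfg⟩ := exists_span_mFourier_norm_sub_le f
    (ε := ε / (2 * (|K| + ‖c‖ + 1))) (by positivity)
  filter_upwards [Metric.tendsto_nhds.1 (hspan g hg) (ε / 2) (by positivity)] with N hN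
  have e1 : ‖Λ N f - Λ N g‖ ≤ |K| * ‖f - g‖ := by
    rw [← map_sub]
    exact (hK N _).trans (by gcongr; exact le_abs_self K)
  have e2 : ‖c * (∫ x, g x) - c * ∫ x, f x‖ ≤ ‖c‖ * ‖f - g‖ := by
    rw [← mul_sub, norm_mul, ← integral_sub (integrable_of_continuous g.continuous)
      (integrable_of_continuous f.continuous)]
    gcongr
    refine (norm_integral_le_of_norm_le_const (C := ‖f - g‖) (ae_of_all _ fun x => ?_)).trans
      (by simp)
    rw [norm_sub_rev]
    exact (f - g).norm_coe_le_norm x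
  have e3 : (|K| + ‖c‖) * ‖f - g‖ < ε / 2 := by
    have : (|K| + ‖c‖ + 1) * ‖f - g‖ ≤ ε / 2 := by
      calc _ ≤ (|K| + ‖c‖ + 1) * (ε / (2 * (|K| + ‖c‖ + 1))) := by gcongr
        _ = ε / 2 := by field_simp
    rcases (norm_nonneg (f - g)).eq_or_lt with h0 | h0
    · rw [← h0, mul_zero]; positivity
    · nlinarith
  rw [dist_eq_norm] at hN ⊢
  calc ‖Λ N f - c * ∫ x, f x‖
      = ‖(Λ N f - Λ N g) + (Λ N g - c * ∫ x, g x) + (c * (∫ x, g x) - c * ∫ x, f x)‖ := by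
        congr 1; ring
    _ ≤ ‖Λ N f - Λ N g‖ + ‖Λ N g - c * ∫ x, g x‖ + ‖c * (∫ x, g x) - c * ∫ x, f x‖ := norm_add₃_le
    _ < ε := by nlinarith

/-- Integration of `f(φ(x))` against a weight `w`, as a functional of `f`. -/
noncomputable def weightedIntegral {Ω : Type*} [MeasurableSpace Ω] (μ : Measure Ω)
    (φ : Ω → UnitAddTorus ι) (hφ : Measurable φ) (w : Ω → ℂ) (hw : Integrable w μ) :
    C(UnitAddTorus ι, ℂ) →ₗ[ℂ] ℂ where
  toFun f := ∫ u, f (φ u) * w u ∂μ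
  map_add' f g := by
    have hi : ∀ f : C(UnitAddTorus ι, ℂ), Integrable (fun u => f (φ u) * w u) μ := fun f =>
      hw.bdd_mul (f.continuous.measurable.comp hφ).aestronglyMeasurable
        (ae_of_all _ fun u => f.norm_coe_le_norm (φ u))
    simp only [ContinuousMap.add_apply, add_mul]
    exact integral_add (hi f) (hi g)
  map_smul' a f := by
    simp only [ContinuousMap.smul_apply, smul_eq_mul, mul_assoc, RingHom.id_apply]
    exact integral_const_mul a _

theorem norm_weightedIntegral_le {Ω : Type*} [MeasurableSpace Ω] (μ : Measure Ω)
    (φ : Ω → UnitAddTorus ι) (hφ : Measurable φ) (w : Ω → ℂ) (hw : Integrable w μ)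
    (f : C(UnitAddTorus ι, ℂ)) :
    ‖weightedIntegral μ φ hφ w hw f‖ ≤ (∫ u, ‖w u‖ ∂μ) * ‖f‖ := by
  change ‖∫ u, f (φ u) * w u ∂μ‖ ≤ _
  rw [mul_comm, ← integral_const_mul]
  refine norm_integral_le_of_norm_le (hw.norm.const_mul _) (ae_of_all _ fun u => ?_)
  rw [norm_mul]
  gcongr
  exact f.norm_coe_le_norm (φ u)

/-- Decoupling of a fixed function and a rapidly oscillating one on the torus. -/
theorem tendsto_integral_mul_nsmul (q f : C(UnitAddTorus ι, ℂ)) :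
    Tendsto (fun N : ℕ => ∫ x, q x * f (N • x)) atTop (𝓝 ((∫ x, q x) * ∫ x, f x)) := by
  -- The density argument is applied twice, once for each factor: `key` passes from fast characters
  -- to fast continuous functions, and `this` treats one fast character against any slow function.
  have key : ∀ (f : C(UnitAddTorus ι, ℂ)) (hn : ∀ n : ι → ℤ, Tendsto (fun N : ℕ =>
      ∫ x, mFourier n (N • x) * f x) atTop (𝓝 ((∫ x, f x) * ∫ x, mFourier n x)))
      (g : C(UnitAddTorus ι, ℂ)), Tendsto (fun N : ℕ =>
      ∫ x, g (N • x) * f x) atTop (𝓝 ((∫ x, f x) * ∫ x, g x)) := by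
    intro f hn g
    exact tendsto_of_tendsto_mFourier (fun N : ℕ => weightedIntegral volume
      (fun x : UnitAddTorus ι => N • x) (continuous_nsmul N).measurable f
      (integrable_of_continuous f.continuous)) (∫ u, ‖f u‖)
      (fun N g => norm_weightedIntegral_le _ _ _ _ _ _) _ hn g
  have : ∀ n : ι → ℤ, Tendsto (fun N : ℕ =>
      ∫ x, mFourier n (N • x) * q x) atTop (𝓝 ((∫ x, q x) * ∫ x, mFourier n x)) := by
    intro n
    by_cases hn : n = 0
    · subst hn
      simp [mFourier_zero]
    rw [integral_mFourier_eq_zero hn]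
    -- The roles are exchanged: the fast character is now the weight and `q` the test function. On a
    -- slow character k the integral vanishes once k + N n ≠ 0.
    have h2 := tendsto_of_tendsto_mFourier (ι := ι) (l := atTop)
      (fun N : ℕ => weightedIntegral volume id measurable_id
        (fun x : UnitAddTorus ι => mFourier n (N • x)) (integrable_of_continuous (by fun_prop)))
      1 (fun N g => (norm_weightedIntegral_le _ _ _ _ _ _).trans (by simp [norm_mFourier_apply]))
      0 (fun k => ?_) q
    · simp only [zero_mul, mul_zero] at h2 ⊢
      refine h2.congr fun N => ?_
      exact integral_congr_ae (ae_of_all _ fun x => mul_comm _ _)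
    · rw [zero_mul]
      refine tendsto_const_nhds.congr' ?_
      filter_upwards [eventually_add_zsmul_ne_zero hn k] with N hN
      change _ = ∫ x, mFourier k x * mFourier n (N • x)
      simp_rw [mFourier_nsmul, ← mFourier_add]
      rw [integral_mFourier_eq_zero hN]
  refine (key q this f).congr fun N => ?_
  exact integral_congr_ae (ae_of_all _ fun x => mul_comm _ _)

theorem tendsto_integral_mul_nsmul_real (q f : C(UnitAddTorus ι, ℝ)) :
    Tendsto (fun N : ℕ => ∫ x, q x * f (N • x)) atTop (𝓝 ((∫ x, q x) * ∫ x, f x)) := by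
  have h := tendsto_integral_mul_nsmul (⟨fun x => (q x : ℂ), by fun_prop⟩ : C(UnitAddTorus ι, ℂ))
    ⟨fun x => (f x : ℂ), by fun_prop⟩
  simp only [ContinuousMap.coe_mk, ← Complex.ofReal_mul, integral_complex_ofReal] at h
  exact (Complex.continuous_re.tendsto _).comp h

/-- Odd continuous functions on the circle, with values in `[-1, 1]`, which are close to the
sign of the sine. -/
theorem exists_circle_sign_approx {δ : ℝ≥0∞} (hδ : 0 < δ) :
    ∃ r : C(UnitAddCircle, ℝ), (∀ x, |r x| ≤ 1) ∧ ∫ x, r x = 0 ∧ volume {x | |r x| ≠ 1} ≤ δ := by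
  -- This is sin(2πx); its zeros are 2-torsion points, so they form a finite set.
  let S : UnitAddCircle → ℝ := fun x => (fourier 1 x : ℂ).im
  have hS : Continuous S := Complex.continuous_im.comp (map_continuous (fourier 1))
  have hodd : ∀ x, S (-x) = - S x := fun x => by simp [S, fourier_apply, AddCircle.toCircle_neg]
  have hnull : volume {x | S x = 0} = 0 := by
    have hsub : {x | S x = 0} ⊆ {x : UnitAddCircle | 2 • x = 0} := by
      intro x hx
      have h1 : ‖(fourier 1 x : ℂ)‖ = 1 := by simp [fourier_apply, Circle.norm_coe]
      have h2 : (fourier 1 x : ℂ) ^ 2 = 1 := by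
        have h3 := Complex.sq_norm_sub_sq_im (fourier 1 x : ℂ)
        have h4 : (fourier 1 x : ℂ).im = 0 := hx
        rw [h4, h1] at h3
        apply Complex.ext
        · rw [pow_two, Complex.mul_re, h4, Complex.one_re]; nlinarith
        · rw [pow_two, Complex.mul_im, h4, Complex.one_im]; ring
      have h5 : (AddCircle.toCircle (2 • x) : ℂ) = 1 := by
        rw [← h2, two_smul, AddCircle.toCircle_add]
        simp [fourier_apply, pow_two]
      have h6 : AddCircle.toCircle (2 • x) = AddCircle.toCircle (0 : UnitAddCircle) := by
        apply Subtype.ext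
        rw [h5]; simp
      exact AddCircle.injective_toCircle one_ne_zero h6
    refine measure_mono_null hsub ?_
    have hf : Set.Finite {x : UnitAddCircle | 2 • x = 0} := AddCircle.finite_torsion 1 two_pos
    rw [← Set.biUnion_of_singleton {x : UnitAddCircle | 2 • x = 0},
      measure_biUnion_null_iff hf.countable]
    intro x _
    have h := AddCircle.volume_closedBall (T := 1) (x := x) 0
    rw [Metric.closedBall_zero] at h
    rw [h]
    simp
  have htend : Tendsto (fun k : ℕ => volume {x | |S x| ≤ 1 / ((k : ℝ) + 1)}) atTop (𝓝 0) := by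
    have : {x | S x = 0} = ⋂ k : ℕ, {x | |S x| ≤ 1 / ((k : ℝ) + 1)} := by
      ext x
      simp only [Set.mem_ofPred_eq, Set.mem_iInter]
      constructor
      · intro h k; rw [h, abs_zero]; positivity
      · intro h
        exact abs_nonpos_iff.1 (ge_of_tendsto' tendsto_one_div_add_atTop_nhds_zero_nat h)
    rw [← hnull, this]
    refine tendsto_measure_iInter_atTop (fun k => ?_) ?_ ⟨0, measure_ne_top _ _⟩
    · exact (isClosed_le (hS.abs) continuous_const).measurableSet.nullMeasurableSet
    · intro i j hij x hx
      have hx' : |S x| ≤ 1 / ((j : ℝ) + 1) := hx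
      change |S x| ≤ 1 / ((i : ℝ) + 1)
      refine hx'.trans ?_
      gcongr
  obtain ⟨k, hk⟩ := (htend.eventually (gt_mem_nhds hδ)).exists
  -- Clamping (k + 1) S to [-1, 1] keeps it odd, hence of mean zero, and gives ±1 wherever |S| >
  -- 1/(k + 1).
  let r : C(UnitAddCircle, ℝ) :=
    ⟨fun x => max (-1) (min 1 (((k : ℝ) + 1) * S x)), by fun_prop⟩
  refine ⟨r, fun x => ?_, ?_, ?_⟩
  · rw [abs_le]
    exact ⟨le_max_left _ _, max_le (by norm_num) (min_le_left _ _)⟩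
  · have hr : ∀ x, r (-x) = - r x := by
      intro x
      simp only [r, ContinuousMap.coe_mk, hodd, mul_neg]
      generalize ((k : ℝ) + 1) * S x = y
      rcases le_total y 1 with h | h <;> rcases le_total (-1) y with h' | h'
      · rw [min_eq_right (by linarith), max_eq_right (by linarith), min_eq_right h,
          max_eq_right (by linarith)]
      · rw [min_eq_left (by linarith), max_eq_right (by linarith), min_eq_right h,
          max_eq_left (by linarith)]; norm_num
      · rw [min_eq_right (by linarith), max_eq_left (by linarith), min_eq_left h,
          max_eq_right (by linarith)]
      · linarith
    have h := integral_neg_eq_self (fun x => r x) (volume : Measure UnitAddCircle)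
    simp_rw [hr] at h
    rw [integral_neg] at h
    linarith
  · refine (measure_mono ?_).trans hk.le
    intro x hx
    by_contra hcon
    apply hx
    simp only [Set.mem_ofPred_eq, not_le] at hcon
    have hk0 : (0 : ℝ) < (k : ℝ) + 1 := by positivity
    rw [div_lt_iff₀ hk0] at hcon
    simp only [r, ContinuousMap.coe_mk]
    rcases le_total 0 (S x) with h | h
    · rw [abs_of_nonneg h] at hcon
      rw [min_eq_left (by linarith), max_eq_right (by norm_num)]; norm_num
    · rw [abs_of_nonpos h] at hcon
      rw [min_eq_right (by linarith), max_eq_left (by linarith)]; norm_num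

end Torus

/-! ### The Bellman function on the torus and its midpoint concavity -/

section Bellman

variable {ι : Type*} [Fintype ι]

/-- The function `|y|^q - C^q |x|^q`. -/
noncomputable def powerGap (q C : ℝ) (z : ℂ × ℂ) : ℝ := ‖z.2‖ ^ q - C ^ q * ‖z.1‖ ^ q

theorem continuous_powerGap {q : ℝ} (hq : 0 ≤ q) (C : ℝ) : Continuous (powerGap q C) := by
  have h : Continuous fun t : ℝ => t ^ q := Real.continuous_rpow_const hq
  unfold powerGap
  exact (h.comp (by fun_prop)).sub ((h.comp (by fun_prop)).const_mul _)

/-- The pair formed by a character of the torus and its multiple by `a`. -/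
noncomputable def charPair (a : ℝ) (n : ι → ℤ) : C(UnitAddTorus ι, ℂ × ℂ) :=
  ⟨fun t => (mFourier n t, a * mFourier n t), by fun_prop⟩

/-- Pairs `(φ, ψ)` of trigonometric polynomials without constant term such that `ψ` is the image
of `φ` under the multiplier with symbol `σ`. -/
noncomputable def symbolPairs (σ : (ι → ℤ) → ℝ) : Submodule ℂ C(UnitAddTorus ι, ℂ × ℂ) :=
  Submodule.span ℂ {w | ∃ n ≠ 0, w = charPair (σ n) n}

theorem charPair_mem_symbolPairs (σ : (ι → ℤ) → ℝ) {n : ι → ℤ} (hn : n ≠ 0) :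
    charPair (σ n) n ∈ symbolPairs σ :=
  Submodule.subset_span ⟨n, hn, rfl⟩

/-- The product of a continuous function and a rapidly oscillating symbol pair is uniformly close
to a symbol pair. -/
theorem eventually_exists_symbolPairs_near {σ : (ι → ℤ) → ℝ}
    (hσ : ∀ n ≠ 0, ∀ l, Tendsto (fun N : ℕ => σ (l + (N : ℤ) • n)) atTop (𝓝 (σ n)))
    (q : C(UnitAddTorus ι, ℂ)) {w : C(UnitAddTorus ι, ℂ × ℂ)} (hw : w ∈ symbolPairs σ)
    {ε : ℝ} (hε : 0 < ε) :
    ∀ᶠ N : ℕ in atTop, ∃ w' ∈ symbolPairs σ, ∀ t, ‖w' t - q t • w (N • t)‖ ≤ ε := by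
  have hchar : ∀ l n : ι → ℤ, n ≠ 0 → ∀ ε : ℝ, 0 < ε → ∀ᶠ N : ℕ in atTop,
      ∃ w' ∈ symbolPairs σ, ∀ t, ‖w' t - mFourier l t • charPair (σ n) n (N • t)‖ ≤ ε := by
    intro l n hn ε hε
    filter_upwards [eventually_add_zsmul_ne_zero hn l,
      Metric.tendsto_nhds.1 (hσ n hn l) ε hε] with N hN hd
    refine ⟨_, charPair_mem_symbolPairs σ hN, fun t => ?_⟩
    -- The product with a slow character is again a character, of frequency l + N n. The first
    -- coordinates agree exactly; the only error comes from replacing σ(l + N n) by σ(n).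
    have : charPair (σ (l + (N : ℤ) • n)) (l + (N : ℤ) • n) t
        - mFourier l t • charPair (σ n) n (N • t)
        = (0, ((σ (l + (N : ℤ) • n) - σ n : ℝ) : ℂ) * mFourier (l + (N : ℤ) • n) t) := by
      ext
      · simp [charPair, mFourier_nsmul, mFourier_add]
      · simp only [charPair, ContinuousMap.coe_mk, mFourier_nsmul, mFourier_add, Prod.snd_sub,
          Prod.smul_snd, smul_eq_mul]
        push_cast
        ring
    rw [this, Prod.norm_mk, norm_mul, norm_mFourier_apply, mul_one, Complex.norm_real, norm_zero,
      max_eq_right (norm_nonneg _), ← dist_eq_norm]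
    exact hd.le
  have hpoly : ∀ p ∈ Submodule.span ℂ (Set.range (mFourier (d := ι))), ∀ n : ι → ℤ, n ≠ 0 →
      ∀ ε : ℝ, 0 < ε → ∀ᶠ N : ℕ in atTop,
      ∃ w' ∈ symbolPairs σ, ∀ t, ‖w' t - p t • charPair (σ n) n (N • t)‖ ≤ ε := by
    intro p hp n hn
    induction hp using Submodule.span_induction with
    | mem p hp => obtain ⟨l, rfl⟩ := hp; exact hchar l n hn
    | zero => exact fun ε hε => Eventually.of_forall fun N => ⟨0, zero_mem _, fun t => by
        simpa using hε.le⟩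
    | add p p' _ _ h h' =>
      intro ε hε
      filter_upwards [h (ε / 2) (by positivity), h' (ε / 2) (by positivity)] with N h1 h2
      obtain ⟨w1, hw1, h1⟩ := h1
      obtain ⟨w2, hw2, h2⟩ := h2
      refine ⟨w1 + w2, add_mem hw1 hw2, fun t => ?_⟩
      calc _ = ‖(w1 t - p t • charPair (σ n) n (N • t))
            + (w2 t - p' t • charPair (σ n) n (N • t))‖ := by
            congr 1; simp only [ContinuousMap.add_apply, add_smul]; abel
        _ ≤ ε / 2 + ε / 2 := norm_add_le_of_le (h1 t) (h2 t)
        _ = ε := by ring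
    | smul a p _ h =>
      intro ε hε
      filter_upwards [h (ε / (‖a‖ + 1)) (by positivity)] with N h1
      obtain ⟨w1, hw1, h1⟩ := h1
      refine ⟨a • w1, Submodule.smul_mem _ _ hw1, fun t => ?_⟩
      calc _ = ‖a • (w1 t - p t • charPair (σ n) n (N • t))‖ := by
            congr 1; simp only [ContinuousMap.smul_apply, smul_sub, smul_assoc]
        _ ≤ ‖a‖ * (ε / (‖a‖ + 1)) := by rw [norm_smul]; gcongr; exact h1 t
        _ ≤ ε := by
          rw [mul_div_assoc', div_le_iff₀ (by positivity)]
          nlinarith [norm_nonneg a]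
  have hpoly2 : ∀ p ∈ Submodule.span ℂ (Set.range (mFourier (d := ι))), ∀ ε : ℝ, 0 < ε →
      ∀ᶠ N : ℕ in atTop, ∃ w' ∈ symbolPairs σ, ∀ t, ‖w' t - p t • w (N • t)‖ ≤ ε := by
    intro p hp
    induction hw using Submodule.span_induction with
    | mem w hw => obtain ⟨n, hn, rfl⟩ := hw; exact hpoly p hp n hn
    | zero => exact fun ε hε => Eventually.of_forall fun N => ⟨0, zero_mem _, fun t => by
        simpa using hε.le⟩
    | add v v' _ _ h h' =>
      intro ε hε
      filter_upwards [h (ε / 2) (by positivity), h' (ε / 2) (by positivity)] with N h1 h2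
      obtain ⟨w1, hw1, h1⟩ := h1
      obtain ⟨w2, hw2, h2⟩ := h2
      refine ⟨w1 + w2, add_mem hw1 hw2, fun t => ?_⟩
      calc _ = ‖(w1 t - p t • v (N • t)) + (w2 t - p t • v' (N • t))‖ := by
            congr 1; simp only [ContinuousMap.add_apply, smul_add]; abel
        _ ≤ ε / 2 + ε / 2 := norm_add_le_of_le (h1 t) (h2 t)
        _ = ε := by ring
    | smul a v _ h =>
      intro ε hε
      filter_upwards [h (ε / (‖a‖ + 1)) (by positivity)] with N h1
      obtain ⟨w1, hw1, h1⟩ := h1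
      refine ⟨a • w1, Submodule.smul_mem _ _ hw1, fun t => ?_⟩
      calc _ = ‖a • (w1 t - p t • v (N • t))‖ := by
            congr 1; simp only [ContinuousMap.smul_apply, smul_sub]
            rw [smul_comm]
        _ ≤ ‖a‖ * (ε / (‖a‖ + 1)) := by rw [norm_smul]; gcongr; exact h1 t
        _ ≤ ε := by
          rw [mul_div_assoc', div_le_iff₀ (by positivity)]
          nlinarith [norm_nonneg a]
  obtain ⟨p, hp, hpq⟩ := exists_span_mFourier_norm_sub_le q
    (ε := ε / (2 * (‖w‖ + 1))) (by positivity)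
  filter_upwards [hpoly2 p hp (ε / 2) (by positivity)] with N h1
  obtain ⟨w1, hw1, h1⟩ := h1
  refine ⟨w1, hw1, fun t => ?_⟩
  have h3 : ‖(p t - q t) • w (N • t)‖ ≤ ε / 2 := by
    rw [norm_smul, norm_sub_rev]
    calc _ ≤ ε / (2 * (‖w‖ + 1)) * (‖w‖ + 1) := by
          gcongr
          · exact ((q - p).norm_coe_le_norm t).trans hpq
          · exact (w.norm_coe_le_norm _).trans (by linarith)
      _ = ε / 2 := by field_simp
  calc _ = ‖(w1 t - p t • w (N • t)) + (p t - q t) • w (N • t)‖ := by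
        congr 1; rw [sub_smul]; abel
    _ ≤ ε / 2 + ε / 2 := norm_add_le_of_le (h1 t) h3
    _ = ε := by ring

/-- Mean zero functions of a single integer combination of the variables are, up to uniform errors,
eigenfunctions of the multiplier. -/
theorem exists_symbolPairs_near_ridge {σ : (ι → ℤ) → ℝ}
    (hσ : ∀ n ≠ 0, ∀ j : ℤ, j ≠ 0 → σ (j • n) = σ n) {n : ι → ℤ} (hn : n ≠ 0)
    (r : C(UnitAddCircle, ℂ)) (hr : ∫ x, r x = 0) {ε : ℝ} (hε : 0 < ε) :
    ∃ w ∈ symbolPairs σ, ∀ t, ‖w t - r (torusChar n t) • ((1, (σ n : ℂ)) : ℂ × ℂ)‖ ≤ ε := by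
  have hint : ∀ g : C(UnitAddCircle, ℂ), Integrable g := fun g =>
    integrableOn_univ.1 (g.continuous.continuousOn.integrableOn_compact isCompact_univ)
  set h : ℂ × ℂ := (1, (σ n : ℂ)) with hh
  -- Only frequencies j n occur, and for j ≠ 0 they share the symbol value σ(n). Subtracting the
  -- mean removes j = 0, which symbol pairs do not allow.
  have hpoly : ∀ g ∈ Submodule.span ℂ (Set.range (fourier (T := (1 : ℝ)))),
      ∃ w ∈ symbolPairs σ, ∀ t, w t = (g (torusChar n t) - ∫ x, g x) • h := by
    intro g hg
    induction hg using Submodule.span_induction with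
    | mem g hg =>
      obtain ⟨j, rfl⟩ := hg
      by_cases hj : j = 0
      · subst hj
        exact ⟨0, zero_mem _, fun t => by simp⟩
      · have hjn : j • n ≠ 0 := smul_ne_zero hj hn
        refine ⟨_, charPair_mem_symbolPairs σ hjn, fun t => ?_⟩
        rw [integral_fourier_eq_zero hj, sub_zero, fourier_torusChar, hσ n hn j hj]
        simp [charPair, hh, mul_comm]
    | zero => exact ⟨0, zero_mem _, fun t => by simp⟩
    | add g g' _ _ ih ih' =>
      obtain ⟨w, hw, h1⟩ := ih
      obtain ⟨w', hw', h1'⟩ := ih'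
      refine ⟨w + w', add_mem hw hw', fun t => ?_⟩
      have : ∫ x, (g + g') x = (∫ x, g x) + ∫ x, g' x := integral_add (hint g) (hint g')
      rw [ContinuousMap.add_apply, ContinuousMap.add_apply, h1, h1', this, ← add_smul]
      congr 1; ring
    | smul a g _ ih =>
      obtain ⟨w, hw, h1⟩ := ih
      refine ⟨a • w, Submodule.smul_mem _ _ hw, fun t => ?_⟩
      have : ∫ x, (a • g) x = a * ∫ x, g x := integral_const_mul a g
      rw [ContinuousMap.smul_apply, ContinuousMap.smul_apply, h1, this, smul_smul]
      congr 1; simp only [smul_eq_mul]; ring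
  obtain ⟨g, hg, hrg⟩ := UnitAddCircle.exists_span_fourier_norm_sub_le r
    (ε := ε / (2 * (‖h‖ + 1))) (by positivity)
  obtain ⟨w, hw, hwt⟩ := hpoly g hg
  refine ⟨w, hw, fun t => ?_⟩
  have hg0 : ‖∫ x, g x‖ ≤ ‖r - g‖ := by
    have : ∫ x, g x = ∫ x, (g x - r x) := by
      rw [integral_sub (hint g) (hint r), hr, sub_zero]
    rw [this]
    refine (norm_integral_le_of_norm_le_const (C := ‖r - g‖) (ae_of_all _ fun x => ?_)).trans
      (by simp)
    rw [norm_sub_rev]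
    exact (r - g).norm_coe_le_norm x
  have hgr : ‖g (torusChar n t) - r (torusChar n t)‖ ≤ ‖r - g‖ := by
    rw [norm_sub_rev]
    exact (r - g).norm_coe_le_norm _
  rw [hwt, ← sub_smul, norm_smul]
  calc _ ≤ (2 * (ε / (2 * (‖h‖ + 1)))) * (‖h‖ + 1) := by
        gcongr
        · calc _ = ‖(g (torusChar n t) - r (torusChar n t)) - ∫ x, g x‖ := by congr 1; ring
            _ ≤ ‖r - g‖ + ‖r - g‖ := norm_sub_le_of_le hgr hg0
            _ ≤ _ := by linarith
        · linarith
    _ = ε := by field_simp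

/-- The mean value of `V(z + w)`, where `V(x,y) = |y|^q - C^q |x|^q`. -/
noncomputable def bellmanMean (q C : ℝ) (w : C(UnitAddTorus ι, ℂ × ℂ)) (z : ℂ × ℂ) : ℝ :=
  ∫ t, powerGap q C (z + w t)

/-- The Bellman function of a multiplier on the torus. -/
noncomputable def bellman (q C : ℝ) (σ : (ι → ℤ) → ℝ) (z : ℂ × ℂ) : ℝ :=
  ⨆ w : symbolPairs σ, bellmanMean q C w.1 z

theorem integrable_powerGap_comp {q : ℝ} (hq : 0 ≤ q) (C : ℝ) {f : UnitAddTorus ι → ℂ × ℂ}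
    (hf : Continuous f) : Integrable fun t => powerGap q C (f t) :=
  integrable_of_continuous ((continuous_powerGap hq C).comp hf)

/-- A continuous function on `ℂ × ℂ` is bounded and uniformly continuous on bounded sets. -/
theorem exists_bound_and_modulus {V : ℂ × ℂ → ℝ} (hV : Continuous V) (R : ℝ) {ε : ℝ}
    (hε : 0 < ε) :
    ∃ K > 0, (∀ z, ‖z‖ ≤ R → |V z| ≤ K) ∧
      ∃ δ > 0, ∀ z z', ‖z‖ ≤ R → ‖z'‖ ≤ R → ‖z - z'‖ ≤ δ → |V z - V z'| ≤ ε := by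
  have hc : IsCompact (Metric.closedBall (0 : ℂ × ℂ) R) := isCompact_closedBall _ _
  obtain ⟨K, hK⟩ := hc.exists_bound_of_continuousOn hV.continuousOn
  have hu := hc.uniformContinuousOn_of_continuous hV.continuousOn
  obtain ⟨δ, hδ, h⟩ := Metric.uniformContinuousOn_iff.1 hu ε hε
  refine ⟨|K| + 1, by positivity, fun z hz => ?_, δ / 2, by positivity, fun z z' hz hz' hd => ?_⟩
  · exact (hK z (by simpa using hz)).trans ((le_abs_self K).trans (by linarith))
  · rw [← Real.dist_eq]
    refine (h z (by simpa using hz) z' (by simpa using hz') ?_).le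
    rw [dist_eq_norm]; linarith

/-- A competitor for `bellman` at z is built by a random first step ±s(1, σ(n)), realized by an
approximate sign of ⟨n, t⟩, followed by a fast copy of `w₁` or `w₂` according to that sign. It is
within any prescribed error of a symbol pair, and its mean is nearly the average of the two given
means. -/
theorem bellmanMean_add_bellmanMean_le {q : ℝ} (hq : 0 ≤ q) (C : ℝ) {σ : (ι → ℤ) → ℝ}
    (hσ : ∀ n ≠ 0, ∀ l, Tendsto (fun N : ℕ => σ (l + (N : ℤ) • n)) atTop (𝓝 (σ n)))
    (hσ' : ∀ n ≠ 0, ∀ j : ℤ, j ≠ 0 → σ (j • n) = σ n)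
    (hbdd : ∀ z, BddAbove (Set.range fun w : symbolPairs σ => bellmanMean q C w.1 z))
    {n : ι → ℤ} (hn : n ≠ 0) {w₁ w₂ : C(UnitAddTorus ι, ℂ × ℂ)} (hw₁ : w₁ ∈ symbolPairs σ)
    (hw₂ : w₂ ∈ symbolPairs σ) (z : ℂ × ℂ) (s : ℝ) :
    bellmanMean q C w₁ (z - s • ((1, (σ n : ℂ)) : ℂ × ℂ)) +
      bellmanMean q C w₂ (z + s • ((1, (σ n : ℂ)) : ℂ × ℂ)) ≤ 2 * bellman q C σ z := by
  set h : ℂ × ℂ := (1, (σ n : ℂ)) with hh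
  set V := powerGap q C with hVdef
  have hV : Continuous V := continuous_powerGap hq C
  refine le_of_forall_pos_le_add fun ε hε => ?_
  set R : ℝ := ‖z‖ + ‖s • h‖ + ‖w₁‖ + ‖w₂‖ + 1 with hR
  obtain ⟨K, hK, hVK, δ₀, hδ₀, hVu⟩ := exists_bound_and_modulus hV R
    (ε := ε / 8) (by positivity)
  obtain ⟨δ, hδ, hδδ₀, hδ1⟩ : ∃ δ > 0, δ ≤ δ₀ ∧ δ ≤ 1 :=
    ⟨min δ₀ 1, by positivity, min_le_left _ _, min_le_right _ _⟩
  -- Off the set where the sign is exact the integrand is wrong by at most 2K, so measure ε/(16K)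
  -- costs ε/8.
  obtain ⟨r, hr1, hr0, hrm⟩ := exists_circle_sign_approx
    (δ := ENNReal.ofReal (ε / (16 * K))) (by simp; positivity)
  let ρ : C(UnitAddTorus ι, ℝ) := ⟨fun t => r (torusChar n t),
    r.continuous.comp (continuous_torusChar n)⟩
  have hρ1 : ∀ t, |ρ t| ≤ 1 := fun t => hr1 _
  have hmp := measurePreserving_torusChar hn
  have hρ0 : ∫ t, ρ t = 0 := by
    rw [← hr0, ← hmp.map_eq, integral_map hmp.measurable.aemeasurable]
    · rfl
    · exact r.continuous.aestronglyMeasurable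
  have hmeas : MeasurableSet {x | |r x| ≠ 1} :=
    (isClosed_eq (r.continuous.abs) continuous_const).measurableSet.compl
  have hρm : volume.real {t | |ρ t| ≠ 1} ≤ ε / (16 * K) := by
    have : volume {t | |ρ t| ≠ 1} = volume {x | |r x| ≠ 1} :=
      hmp.measure_preimage hmeas.nullMeasurableSet
    rw [Measure.real, this]
    exact ENNReal.toReal_le_of_le_ofReal (by positivity) hrm
  -- `q₁` and `q₂` form a partition of unity, equal to the indicators of ρ = -1 and ρ = 1 wherever
  -- |ρ| = 1. Each has mean 1/2 because ρ has mean 0.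
  let q₁ : C(UnitAddTorus ι, ℝ) := ⟨fun t => (1 - ρ t) / 2, by fun_prop⟩
  let q₂ : C(UnitAddTorus ι, ℝ) := ⟨fun t => (1 + ρ t) / 2, by fun_prop⟩
  have hρi : Integrable fun t => ρ t := integrable_of_continuous ρ.continuous
  have hq₁ : ∫ t, q₁ t = 1 / 2 := by
    change ∫ t, (1 - ρ t) / 2 = _
    rw [integral_div, integral_sub (integrable_const _) hρi, hρ0]; simp
  have hq₂ : ∫ t, q₂ t = 1 / 2 := by
    change ∫ t, (1 + ρ t) / 2 = _
    rw [integral_div, integral_add (integrable_const _) hρi, hρ0]; simp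
  let V₁ : C(UnitAddTorus ι, ℝ) := ⟨fun t => V (z - s • h + w₁ t), by fun_prop⟩
  let V₂ : C(UnitAddTorus ι, ℝ) := ⟨fun t => V (z + s • h + w₂ t), by fun_prop⟩
  have ev₁ := (tendsto_integral_mul_nsmul_real q₁ V₁).eventually
    (lt_mem_nhds (b := (∫ t, q₁ t) * ∫ t, V₁ t) (a := (∫ t, q₁ t) * (∫ t, V₁ t) - ε / 8)
    (by linarith))
  have ev₂ := (tendsto_integral_mul_nsmul_real q₂ V₂).eventually
    (lt_mem_nhds (b := (∫ t, q₂ t) * ∫ t, V₂ t) (a := (∫ t, q₂ t) * (∫ t, V₂ t) - ε / 8)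
    (by linarith))
  have en₁ := eventually_exists_symbolPairs_near hσ
    (⟨fun t => (q₁ t : ℂ), by fun_prop⟩ : C(UnitAddTorus ι, ℂ)) hw₁ (ε := δ / 3) (by positivity)
  have en₂ := eventually_exists_symbolPairs_near hσ
    (⟨fun t => (q₂ t : ℂ), by fun_prop⟩ : C(UnitAddTorus ι, ℂ)) hw₂ (ε := δ / 3) (by positivity)
  obtain ⟨N, ev₁, ev₂, ⟨u₁, hu₁, hu₁'⟩, ⟨u₂, hu₂, hu₂'⟩⟩ :=
    (ev₁.and (ev₂.and (en₁.and en₂))).exists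
  obtain ⟨u₀, hu₀, hu₀'⟩ := exists_symbolPairs_near_ridge hσ' hn
    (⟨fun t => ((s * r t : ℝ) : ℂ), by fun_prop⟩ : C(UnitAddCircle, ℂ))
    (by
      change ∫ x, ((s * r x : ℝ) : ℂ) = 0
      rw [integral_complex_ofReal, integral_const_mul, hr0]; simp) (ε := δ / 3) (by positivity)
  -- The ideal competitor, not itself z plus a symbol pair. Its three oscillating terms are
  -- approximated by `u₀`, `u₁`, `u₂` within δ/3 each; the slack 1 in R absorbs this error.
  let Φ : UnitAddTorus ι → ℂ × ℂ := fun t =>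
    z + (s * ρ t) • h + q₁ t • w₁ (N • t) + q₂ t • w₂ (N • t)
  have hΦc : Continuous Φ := by
    have : Continuous fun t : UnitAddTorus ι => N • t := continuous_nsmul N
    fun_prop
  have hq₁b : ∀ t, 0 ≤ q₁ t ∧ q₁ t ≤ 1 := fun t => by
    have := abs_le.1 (hρ1 t)
    change 0 ≤ (1 - ρ t) / 2 ∧ (1 - ρ t) / 2 ≤ 1
    constructor <;> linarith
  have hq₂b : ∀ t, 0 ≤ q₂ t ∧ q₂ t ≤ 1 := fun t => by
    have := abs_le.1 (hρ1 t)
    change 0 ≤ (1 + ρ t) / 2 ∧ (1 + ρ t) / 2 ≤ 1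
    constructor <;> linarith
  have hw₁b : ∀ t, ‖w₁ t‖ ≤ ‖w₁‖ := fun t => w₁.norm_coe_le_norm t
  have hw₂b : ∀ t, ‖w₂ t‖ ≤ ‖w₂‖ := fun t => w₂.norm_coe_le_norm t
  have hΦR : ∀ t, ‖Φ t‖ ≤ R - 1 := by
    intro t
    have a1 : ‖(s * ρ t) • h‖ ≤ ‖s • h‖ := by
      rw [mul_comm, mul_smul, norm_smul]
      exact mul_le_of_le_one_left (norm_nonneg _) (hρ1 t)
    have a2 : ‖q₁ t • w₁ (N • t)‖ ≤ ‖w₁‖ := by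
      rw [norm_smul, Real.norm_of_nonneg (hq₁b t).1]
      exact (mul_le_of_le_one_left (norm_nonneg _) (hq₁b t).2).trans (hw₁b _)
    have a3 : ‖q₂ t • w₂ (N • t)‖ ≤ ‖w₂‖ := by
      rw [norm_smul, Real.norm_of_nonneg (hq₂b t).1]
      exact (mul_le_of_le_one_left (norm_nonneg _) (hq₂b t).2).trans (hw₂b _)
    have a4 : ‖Φ t‖ ≤ _ := norm_add₄_le
    linarith
  let w := u₀ + u₁ + u₂
  have hw : w ∈ symbolPairs σ := add_mem (add_mem hu₀ hu₁) hu₂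
  have hclose : ∀ t, ‖(z + w t) - Φ t‖ ≤ δ := by
    intro t
    calc _ = ‖(u₀ t - ((s * r (torusChar n t) : ℝ) : ℂ) • h) + (u₁ t - (q₁ t : ℂ) • w₁ (N • t))
          + (u₂ t - (q₂ t : ℂ) • w₂ (N • t))‖ := by
          congr 1
          simp only [w, Φ, ContinuousMap.add_apply, Complex.coe_smul]
          change _ = u₀ t - (s * ρ t) • h + _ + _
          abel
      _ ≤ δ / 3 + δ / 3 + δ / 3 :=
          norm_add_le_of_le (norm_add_le_of_le (hu₀' t) (hu₁' t)) (hu₂' t)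
      _ = δ := by ring
  have hmean : (∫ t, V (Φ t)) - ε / 8 ≤ bellmanMean q C w z := by
    have : ∫ t, (V (Φ t) - ε / 8) ≤ ∫ t, V (z + w t) := by
      refine integral_mono ((integrable_powerGap_comp hq C hΦc).sub (integrable_const _))
        (integrable_powerGap_comp hq C (by fun_prop)) fun t => ?_
      have b1 : ‖z + w t‖ ≤ R := by
        have := norm_le_insert' (z + w t) (Φ t)
        linarith [hclose t, hΦR t]
      have := abs_le.1 (hVu _ _ b1 ((hΦR t).trans (by linarith)) ((hclose t).trans hδδ₀))
      simp only
      linarith [this.1]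
    rw [integral_sub (integrable_powerGap_comp hq C hΦc) (integrable_const _)] at this
    simpa [bellmanMean] using this
  have hmS : MeasurableSet {t | |ρ t| ≠ 1} :=
    (isClosed_eq (ρ.continuous.abs) continuous_const).measurableSet.compl
  -- Equality where |ρ| = 1. Elsewhere both V(Φ) and the convex combination lie in [-K, K].
  have hpt : ∀ t, q₁ t * V₁ (N • t) + q₂ t * V₂ (N • t)
      - Set.indicator {t | |ρ t| ≠ 1} (fun _ => 2 * K) t ≤ V (Φ t) := by
    intro t
    by_cases ht : |ρ t| = 1
    · rw [Set.indicator_of_notMem (by simpa using ht), sub_zero]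
      rcases eq_or_eq_neg_of_abs_eq ht with h1 | h1
      · have e1 : q₁ t = 0 := by change (1 - ρ t) / 2 = 0; rw [h1]; norm_num
        have e2 : q₂ t = 1 := by change (1 + ρ t) / 2 = 1; rw [h1]; norm_num
        have e3 : Φ t = z + s • h + w₂ (N • t) := by
          simp [Φ, e1, e2, h1]
        rw [e1, e2, e3, zero_mul, zero_add, one_mul]
        rfl
      · have e1 : q₁ t = 1 := by change (1 - ρ t) / 2 = 1; rw [h1]; norm_num
        have e2 : q₂ t = 0 := by change (1 + ρ t) / 2 = 0; rw [h1]; norm_num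
        have e3 : Φ t = z - s • h + w₁ (N • t) := by
          simp [Φ, e1, e2, h1, sub_eq_add_neg]
        rw [e1, e2, e3, zero_mul, add_zero, one_mul]
        rfl
    · rw [Set.indicator_of_mem (by simpa using ht)]
      have c1 : |V₁ (N • t)| ≤ K := by
        refine hVK _ ?_
        have := norm_add_le (z - s • h) (w₁ (N • t))
        have := norm_sub_le z (s • h)
        linarith [hw₁b (N • t), norm_nonneg w₂]
      have c2 : |V₂ (N • t)| ≤ K := by
        refine hVK _ ?_
        have := norm_add_le (z + s • h) (w₂ (N • t))
        have := norm_add_le z (s • h)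
        linarith [hw₂b (N • t), norm_nonneg w₁]
      have c3 : |V (Φ t)| ≤ K := hVK _ ((hΦR t).trans (by linarith))
      have c4 : q₁ t + q₂ t = 1 := by
        change (1 - ρ t) / 2 + (1 + ρ t) / 2 = 1
        ring
      have d1 := mul_le_mul_of_nonneg_left (abs_le.1 c1).2 (hq₁b t).1
      have d2 := mul_le_mul_of_nonneg_left (abs_le.1 c2).2 (hq₂b t).1
      have : q₁ t * K + q₂ t * K = K := by rw [← add_mul, c4, one_mul]
      linarith [(abs_le.1 c3).1]
  have hi₁ : Integrable fun t => q₁ t * V₁ (N • t) := integrable_of_continuous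
    (q₁.continuous.mul (V₁.continuous.comp (continuous_nsmul N)))
  have hi₂ : Integrable fun t => q₂ t * V₂ (N • t) := integrable_of_continuous
    (q₂.continuous.mul (V₂.continuous.comp (continuous_nsmul N)))
  have hi₃ : Integrable (Set.indicator {t | |ρ t| ≠ 1} (fun _ => 2 * K)) :=
    (integrable_const _).indicator hmS
  have hint := integral_mono ((hi₁.add hi₂).sub hi₃) (integrable_powerGap_comp hq C hΦc) hpt
  have e0 : ∫ t, ((fun t => q₁ t * V₁ (N • t)) + (fun t => q₂ t * V₂ (N • t))
      - Set.indicator {t | |ρ t| ≠ 1} (fun _ => 2 * K)) t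
      = (∫ t, q₁ t * V₁ (N • t)) + (∫ t, q₂ t * V₂ (N • t))
        - volume.real {t | |ρ t| ≠ 1} * (2 * K) := by
    rw [integral_sub' (hi₁.add hi₂) hi₃, integral_add' hi₁ hi₂, integral_indicator hmS]
    simp
  have hint' := e0.symm.le.trans hint
  have hKm : volume.real {t | |ρ t| ≠ 1} * (2 * K) ≤ ε / 8 := by
    calc _ ≤ ε / (16 * K) * (2 * K) := by gcongr
      _ = ε / 8 := by field_simp; norm_num
  have hU : bellmanMean q C w z ≤ bellman q C σ z := le_ciSup (hbdd z) ⟨w, hw⟩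
  rw [hq₁] at ev₁
  rw [hq₂] at ev₂
  have f₁ : ∫ t, V₁ t = bellmanMean q C w₁ (z - s • h) := rfl
  have f₂ : ∫ t, V₂ t = bellmanMean q C w₂ (z + s • h) := rfl
  rw [f₁] at ev₁
  rw [f₂] at ev₂
  -- Four errors of ε/8 arise: two from decoupling, one from the inexact sign, one from replacing Φ.
  -- They add up to ε/2, and the inequality is then doubled.
  linarith

end Bellman

/-! ### Midpoint concavity and lower semicontinuity -/

/-- A lower semicontinuous function on the line which is concave at midpoints is concave. -/
theorem concaveOn_of_midpoint_of_lowerSemicontinuous {g : ℝ → ℝ} (hg : LowerSemicontinuous g)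
    (hmid : ∀ t s, g (t - s) + g (t + s) ≤ 2 * g t) : ConcaveOn ℝ Set.univ g := by
  refine LinearOrder.concaveOn_of_lt convex_univ fun x _ y _ hxy a b ha hb hab => ?_
  by_contra hcon
  rw [not_le] at hcon
  set κ : ℝ := (g y - g x) / (y - x) with hκ
  have hyx : y - x ≠ 0 := by linarith
  have hκ' : κ * (y - x) = g y - g x := div_mul_cancel₀ _ hyx
  -- Subtracting the chord leaves a function that vanishes at both ends and is negative at `p`. At
  -- its leftmost minimizer `t₁`, the value at t₁ - δ is strictly larger and the value at t₁ + δ is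
  -- no smaller, against the midpoint inequality.
  let D : ℝ → ℝ := fun t => g t + -(g x + κ * (t - x))
  have hD : LowerSemicontinuous D :=
    hg.add (Continuous.lowerSemicontinuous (by fun_prop))
  have hDmid : ∀ t s, D (t - s) + D (t + s) ≤ 2 * D t := fun t s => by
    simp only [D]; linarith [hmid t s]
  have hDx : D x = 0 := by simp [D]
  have hDy : D y = 0 := by simp only [D]; linarith
  set p := a • x + b • y with hp
  have hpI : p ∈ Set.Icc x y := by
    have ha' : a = 1 - b := by linarith
    simp only [hp, smul_eq_mul, ha']
    constructor <;> nlinarith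
  have hDp : D p < 0 := by
    have : κ * (p - x) = b * (g y - g x) := by
      rw [← hκ', hp]; simp only [smul_eq_mul]
      have : a = 1 - b := by linarith
      rw [this]; ring
    have ha' : a = 1 - b := by linarith
    simp only [smul_eq_mul] at hcon
    simp only [D]
    rw [ha'] at hcon
    linarith
  obtain ⟨t₀, ht₀, hmin⟩ := (hD.lowerSemicontinuousOn _).exists_isMinOn ⟨p, hpI⟩ isCompact_Icc
  have hμ : D t₀ < 0 := (hmin hpI).trans_lt hDp
  have hS : IsCompact (Set.Icc x y ∩ D ⁻¹' Set.Iic (D t₀)) :=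
    isCompact_Icc.inter_right (hD.isClosed_preimage _)
  obtain ⟨t₁, ⟨ht₁, ht₁'⟩, hleast⟩ := hS.exists_isLeast ⟨t₀, ht₀, le_refl (D t₀)⟩
  have ht₁' : D t₁ ≤ D t₀ := ht₁'
  have hx1 : x < t₁ := lt_of_le_of_ne ht₁.1 (by rintro rfl; linarith)
  have hy1 : t₁ < y := lt_of_le_of_ne ht₁.2 (by rintro rfl; linarith)
  obtain ⟨δ, hδ, hδx, hδy⟩ : ∃ δ > 0, δ ≤ t₁ - x ∧ δ ≤ y - t₁ :=
    ⟨min (t₁ - x) (y - t₁), lt_min (by linarith) (by linarith), min_le_left _ _, min_le_right _ _⟩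
  have h1 : D t₀ ≤ D (t₁ + δ) := hmin ⟨by linarith, by linarith⟩
  have h2 : D t₀ < D (t₁ - δ) := by
    by_contra h
    have := hleast ⟨⟨by linarith, by linarith⟩, not_lt.1 h⟩
    linarith
  linarith [hDmid t₁ δ]

/-- Convexity of the power applied to a + b = l (a/l) + (1 - l)(b/(1 - l)). As l → 0 the coefficient
of b^q tends to 1, at the price of a large coefficient of a^q. -/
theorem add_rpow_le_weighted {q l : ℝ} (hq : 1 ≤ q) (hl0 : 0 < l) (hl1 : l < 1) {a b : ℝ}
    (ha : 0 ≤ a) (hb : 0 ≤ b) :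
    (a + b) ^ q ≤ l ^ (1 - q) * a ^ q + (1 - l) ^ (1 - q) * b ^ q := by
  have hl1' : 0 < 1 - l := by linarith
  have h := (convexOn_rpow hq).2 (Set.mem_Ici.2 (by positivity : 0 ≤ a / l))
    (Set.mem_Ici.2 (by positivity : 0 ≤ b / (1 - l))) hl0.le hl1'.le (by ring)
  simp only [smul_eq_mul] at h
  rw [mul_div_cancel₀ _ hl0.ne', mul_div_cancel₀ _ hl1'.ne', Real.div_rpow ha hl0.le,
    Real.div_rpow hb hl1'.le] at h
  refine h.trans (le_of_eq ?_)
  rw [Real.rpow_sub hl0, Real.rpow_sub hl1', Real.rpow_one, Real.rpow_one]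
  ring

/-! ### Growth, semicontinuity, symmetry and concavity of the Bellman function -/

section Bellman

variable {ι : Type*} [Fintype ι] {q C C' : ℝ} {σ : (ι → ℤ) → ℝ}

theorem continuous_rpow_norm {X F : Type*} [TopologicalSpace X] [SeminormedAddCommGroup F]
    (hq : 0 ≤ q) {f : X → F} (hf : Continuous f) : Continuous fun t => ‖f t‖ ^ q :=
  (Real.continuous_rpow_const hq).comp hf.norm

/-- The Bellman functionals grow at most like `|z|^q`, if the multiplier has norm less than `C'`
on the torus. -/
theorem exists_bellmanMean_le (hq : 1 < q) (hC : 0 ≤ C) (hCC' : C < C')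
    (hT : ∀ w ∈ symbolPairs σ, ∫ t, ‖(w t).2‖ ^ q ≤ C ^ q * ∫ t, ‖(w t).1‖ ^ q) :
    ∃ K : ℝ, 0 ≤ K ∧ ∀ w ∈ symbolPairs σ, ∀ z, bellmanMean q C' w z ≤ K * ‖z‖ ^ q := by
  have hq0 : 0 ≤ q := by linarith
  -- The weighted inequality is used twice, to remove z from ψ and to restore it in φ, hence the
  -- squared factor. It tends to 1 as l → 0, so the strict gap C < C' absorbs it.
  obtain ⟨l, hl0, hl1, hl⟩ : ∃ l : ℝ, 0 < l ∧ l < 1 ∧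
      (1 - l) ^ (1 - q) * (1 - l) ^ (1 - q) * C ^ q ≤ C' ^ q := by
    have hlt : C ^ q < C' ^ q := Real.rpow_lt_rpow hC hCC' (by linarith)
    have hc : ContinuousAt (fun l : ℝ => (1 - l) ^ (1 - q) * (1 - l) ^ (1 - q) * C ^ q) 0 := by
      have : ContinuousAt (fun l : ℝ => (1 - l) ^ (1 - q)) 0 :=
        ContinuousAt.rpow_const (by fun_prop) (Or.inl (by norm_num))
      exact (this.mul this).mul_const _
    have hev := hc.eventually_lt_const (u := C' ^ q) (by simpa using hlt)
    have h1 : ∀ᶠ l in 𝓝[>] (0 : ℝ), l < 1 :=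
      nhdsWithin_le_nhds (gt_mem_nhds (by norm_num))
    obtain ⟨l, ⟨h2, h3⟩, h4⟩ :=
      (((hev.filter_mono nhdsWithin_le_nhds).and h1).and (self_mem_nhdsWithin (s := Set.Ioi (0 : ℝ)))).exists
    exact ⟨l, h4, h3, h2.le⟩
  set A := l ^ (1 - q) with hA
  set D := (1 - l) ^ (1 - q) with hD
  have hA0 : 0 ≤ A := Real.rpow_nonneg hl0.le _
  have hD0 : 0 ≤ D := Real.rpow_nonneg (by linarith) _
  have hCq : 0 ≤ C ^ q := Real.rpow_nonneg hC _
  refine ⟨A + D * C ^ q * A, by positivity, fun w hw z => ?_⟩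
  have hz1 : ‖z.1‖ ^ q ≤ ‖z‖ ^ q := Real.rpow_le_rpow (norm_nonneg _) (norm_fst_le z) hq0
  have hz2 : ‖z.2‖ ^ q ≤ ‖z‖ ^ q := Real.rpow_le_rpow (norm_nonneg _) (norm_snd_le z) hq0
  have i1 : Integrable fun t => ‖(w t).1‖ ^ q :=
    integrable_of_continuous (continuous_rpow_norm hq0 (by fun_prop))
  have i2 : Integrable fun t => ‖(w t).2‖ ^ q :=
    integrable_of_continuous (continuous_rpow_norm hq0 (by fun_prop))
  have i3 : Integrable fun t => ‖(z + w t).1‖ ^ q :=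
    integrable_of_continuous (continuous_rpow_norm hq0 (by fun_prop))
  have i4 : Integrable fun t => ‖(z + w t).2‖ ^ q :=
    integrable_of_continuous (continuous_rpow_norm hq0 (by fun_prop))
  have b1 : ∫ t, ‖(z + w t).2‖ ^ q ≤ A * ‖z.2‖ ^ q + D * ∫ t, ‖(w t).2‖ ^ q := by
    have := integral_mono i4 ((integrable_const (A * ‖z.2‖ ^ q)).add (i2.const_mul D)) fun t =>
      (Real.rpow_le_rpow (norm_nonneg _) (norm_add_le z.2 (w t).2) hq0).trans
      (add_rpow_le_weighted hq.le hl0 hl1 (norm_nonneg _) (norm_nonneg _))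
    rw [integral_add' (integrable_const _) (i2.const_mul D)] at this
    simpa [integral_const_mul] using this
  have b2 : ∫ t, ‖(w t).1‖ ^ q ≤ A * ‖z.1‖ ^ q + D * ∫ t, ‖(z + w t).1‖ ^ q := by
    have := integral_mono i1 ((integrable_const (A * ‖z.1‖ ^ q)).add (i3.const_mul D)) fun t => by
      have e : (w t).1 = -z.1 + (z + w t).1 := by simp
      have e' := norm_add_le (-z.1) (z + w t).1
      rw [← e, norm_neg] at e'
      exact (Real.rpow_le_rpow (norm_nonneg _) e' hq0).trans
        (add_rpow_le_weighted hq.le hl0 hl1 (norm_nonneg _) (norm_nonneg _))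
    rw [integral_add' (integrable_const _) (i3.const_mul D)] at this
    simpa [integral_const_mul] using this
  have b3 : bellmanMean q C' w z
      = (∫ t, ‖(z + w t).2‖ ^ q) - C' ^ q * ∫ t, ‖(z + w t).1‖ ^ q := by
    rw [← integral_const_mul, ← integral_sub i4 (i3.const_mul _)]
    rfl
  have hI : 0 ≤ ∫ t, ‖(z + w t).1‖ ^ q := integral_nonneg fun t => by positivity
  rw [b3]
  have b4 := hT w hw
  have c1 : D * ∫ t, ‖(w t).2‖ ^ q ≤
      D * (C ^ q * (A * ‖z.1‖ ^ q + D * ∫ t, ‖(z + w t).1‖ ^ q)) := by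
    refine mul_le_mul_of_nonneg_left (b4.trans ?_) hD0
    exact mul_le_mul_of_nonneg_left b2 hCq
  have c2 : D * D * C ^ q * (∫ t, ‖(z + w t).1‖ ^ q) ≤ C' ^ q * ∫ t, ‖(z + w t).1‖ ^ q :=
    mul_le_mul_of_nonneg_right hl hI
  have c3 : D * C ^ q * A * ‖z.1‖ ^ q ≤ D * C ^ q * A * ‖z‖ ^ q :=
    mul_le_mul_of_nonneg_left hz1 (by positivity)
  have c4 : A * ‖z.2‖ ^ q ≤ A * ‖z‖ ^ q := mul_le_mul_of_nonneg_left hz2 hA0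
  nlinarith

theorem continuous_bellmanMean (hq : 0 ≤ q) (w : C(UnitAddTorus ι, ℂ × ℂ)) :
    Continuous (bellmanMean q C w) := by
  refine continuous_iff_continuousAt.2 fun z => Metric.continuousAt_iff.2 fun ε hε => ?_
  obtain ⟨K, -, -, δ, hδ, h⟩ := exists_bound_and_modulus (continuous_powerGap hq C)
    (‖z‖ + 1 + ‖w‖) (ε := ε / 2) (by positivity)
  refine ⟨min δ 1, by positivity, fun {z'} hz' => ?_⟩
  rw [dist_eq_norm] at hz' ⊢
  have h1 : ‖z' - z‖ ≤ δ := hz'.le.trans (min_le_left _ _)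
  have h2 : ‖z' - z‖ ≤ 1 := hz'.le.trans (min_le_right _ _)
  have h3 : ‖z'‖ ≤ ‖z‖ + 1 := by linarith [norm_le_insert' z' z]
  unfold bellmanMean
  rw [← integral_sub (integrable_powerGap_comp hq C (by fun_prop))
    (integrable_powerGap_comp hq C (by fun_prop))]
  refine (norm_integral_le_of_norm_le_const (C := ε / 2) (ae_of_all _ fun t => ?_)).trans_lt
    (by simp; linarith)
  refine h _ _ ?_ ?_ ?_
  · exact norm_add_le_of_le h3 (w.norm_coe_le_norm t)
  · exact norm_add_le_of_le (by linarith) (w.norm_coe_le_norm t)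
  · rwa [add_sub_add_right_eq_sub]

theorem lowerSemicontinuous_bellman (hq : 0 ≤ q)
    (hbdd : ∀ z, BddAbove (Set.range fun w : symbolPairs σ => bellmanMean q C w.1 z)) :
    LowerSemicontinuous (bellman q C σ) :=
  lowerSemicontinuous_ciSup hbdd fun w => (continuous_bellmanMean hq w.1).lowerSemicontinuous

theorem powerGap_le_bellman
    (hbdd : ∀ z, BddAbove (Set.range fun w : symbolPairs σ => bellmanMean q C w.1 z))
    (z : ℂ × ℂ) : powerGap q C z ≤ bellman q C σ z := by
  refine le_of_eq_of_le ?_ (le_ciSup (hbdd z) 0)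
  simp [bellmanMean]

theorem bellman_neg (z : ℂ × ℂ) : bellman q C σ (-z) = bellman q C σ z := by
  unfold bellman
  -- V is even and the symbol pairs are stable under negation.
  refine (Equiv.neg (symbolPairs σ)).iSup_congr fun w => ?_
  refine integral_congr_ae (ae_of_all _ fun t => ?_)
  have : z + ((Equiv.neg (symbolPairs σ)) w).1 t = -(-z + w.1 t) := by
    simp [add_comm]
  change powerGap q C (z + _) = powerGap q C (-z + _)
  rw [this]
  simp only [powerGap, Prod.snd_neg, Prod.fst_neg, norm_neg]

/-- The midpoint inequality defines a closed set of slopes c: its left side is lower semicontinuous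
in c and its right side does not involve c. Hence it passes from the values of σ to their closure.
-/
theorem concaveOn_bellman (hq : 0 ≤ q)
    (hσ : ∀ n ≠ 0, ∀ l, Tendsto (fun N : ℕ => σ (l + (N : ℤ) • n)) atTop (𝓝 (σ n)))
    (hσ' : ∀ n ≠ 0, ∀ j : ℤ, j ≠ 0 → σ (j • n) = σ n)
    (hbdd : ∀ z, BddAbove (Set.range fun w : symbolPairs σ => bellmanMean q C w.1 z))
    {c : ℝ} (hc : c ∈ closure (σ '' {0}ᶜ)) (z : ℂ × ℂ) :
    ConcaveOn ℝ Set.univ fun t : ℝ => bellman q C σ (z + t • ((1, (c : ℂ)) : ℂ × ℂ)) := by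
  have hmid : ∀ z : ℂ × ℂ, ∀ s : ℝ, bellman q C σ (z - s • ((1, (c : ℂ)) : ℂ × ℂ)) +
      bellman q C σ (z + s • ((1, (c : ℂ)) : ℂ × ℂ)) ≤ 2 * bellman q C σ z := by
    intro z s
    have hlsc := lowerSemicontinuous_bellman hq hbdd
    have h1 : LowerSemicontinuous fun c : ℝ => bellman q C σ (z - s • ((1, (c : ℂ)) : ℂ × ℂ)) +
        bellman q C σ (z + s • ((1, (c : ℂ)) : ℂ × ℂ)) :=
      (hlsc.comp (g := fun c : ℝ => z - s • ((1, (c : ℂ)) : ℂ × ℂ)) (by fun_prop)).add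
        (hlsc.comp (g := fun c : ℝ => z + s • ((1, (c : ℂ)) : ℂ × ℂ)) (by fun_prop))
    have h2 : IsClosed {c : ℝ | bellman q C σ (z - s • ((1, (c : ℂ)) : ℂ × ℂ)) +
        bellman q C σ (z + s • ((1, (c : ℂ)) : ℂ × ℂ)) ≤ 2 * bellman q C σ z} :=
      h1.isClosed_preimage (2 * bellman q C σ z)
    refine closure_minimal ?_ h2 hc
    rintro _ ⟨n, hn, rfl⟩
    have h3 : ∀ w₁ w₂ : symbolPairs σ, bellmanMean q C w₁.1 (z - s • ((1, (σ n : ℂ)) : ℂ × ℂ)) +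
      bellmanMean q C w₂.1 (z + s • ((1, (σ n : ℂ)) : ℂ × ℂ)) ≤ 2 * bellman q C σ z :=
      fun w₁ w₂ => bellmanMean_add_bellmanMean_le hq C hσ hσ' hbdd hn w₁.2 w₂.2 z s
    have h4 : bellman q C σ (z - s • ((1, (σ n : ℂ)) : ℂ × ℂ)) ≤ 2 * bellman q C σ z -
        bellman q C σ (z + s • ((1, (σ n : ℂ)) : ℂ × ℂ)) := by
      refine ciSup_le fun w₁ => ?_
      rw [le_sub_comm]
      exact ciSup_le fun w₂ => by linarith [h3 w₁ w₂]
    exact le_sub_iff_add_le.1 h4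
  refine concaveOn_of_midpoint_of_lowerSemicontinuous
    ((lowerSemicontinuous_bellman hq hbdd).comp (by fun_prop)) fun t s => ?_
  have := hmid (z + t • ((1, (c : ℂ)) : ℂ × ℂ)) s
  rwa [add_sub_assoc, ← sub_smul, add_assoc, ← add_smul] at this

end Bellman

/-! ### Supporting lines and abstract Bellman functions -/

/-- The right derivative at `0` of a concave function, as a countable supremum. -/
noncomputable def upperSlope (g : ℝ → ℝ) : ℝ := ⨆ n : ℕ, ((n : ℝ) + 1) * (g (1 / ((n : ℝ) + 1)) - g 0)

/-- Chord slopes through 0 decrease: those to the left bound every term of the supremum, and for t >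
0 a term with 1/(n + 1) < t already exceeds the slope of the chord to t. -/
theorem ConcaveOn.le_add_upperSlope_mul {g : ℝ → ℝ} (hg : ConcaveOn ℝ Set.univ g) (t : ℝ) :
    g t ≤ g 0 + upperSlope g * t := by
  have hneg : ∀ t < 0, ∀ n : ℕ, ((n : ℝ) + 1) * (g (1 / ((n : ℝ) + 1)) - g 0) ≤
      (g t - g 0) / t := by
    intro t ht n
    have hn : (0 : ℝ) < (n : ℝ) + 1 := by positivity
    set s : ℝ := 1 / ((n : ℝ) + 1) with hs
    have hs0 : 0 < s := by positivity
    have hns : (n : ℝ) + 1 = 1 / s := by rw [hs]; field_simp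
    have hst : 0 < s - t := by linarith
    have h := hg.2 (Set.mem_univ t) (Set.mem_univ s) (by positivity : 0 ≤ s / (s - t))
      (div_nonneg (by linarith) hst.le : 0 ≤ -t / (s - t))
      (by rw [← add_div, ← sub_eq_add_neg, div_self hst.ne'])
    have h0 : (s / (s - t)) • t + (-t / (s - t)) • s = 0 := by
      simp only [smul_eq_mul]; ring
    rw [h0] at h
    simp only [smul_eq_mul] at h
    have h1 : s * g t + -t * g s ≤ g 0 * (s - t) := by
      rw [← div_le_iff₀ hst]
      refine le_trans (le_of_eq ?_) h
      ring
    rw [hns, le_div_iff_of_neg ht, div_mul_eq_mul_div, div_mul_eq_mul_div, le_div_iff₀ hs0]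
    linarith
  have hbdd : BddAbove (Set.range fun n : ℕ => ((n : ℝ) + 1) * (g (1 / ((n : ℝ) + 1)) - g 0)) := by
    refine ⟨(g (-1) - g 0) / (-1), ?_⟩
    rintro _ ⟨n, rfl⟩
    exact hneg (-1) (by norm_num) n
  rcases lt_trichotomy t 0 with ht | rfl | ht
  · have h : upperSlope g ≤ (g t - g 0) / t := ciSup_le (hneg t ht)
    rw [le_div_iff_of_neg ht] at h
    linarith
  · simp
  · obtain ⟨n, hn⟩ := exists_nat_one_div_lt ht
    have hn0 : (0 : ℝ) < (n : ℝ) + 1 := by positivity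
    have hle : ((n : ℝ) + 1) * (g (1 / ((n : ℝ) + 1)) - g 0) ≤ upperSlope g := le_ciSup hbdd n
    set s : ℝ := 1 / ((n : ℝ) + 1) with hs
    have hs0 : 0 < s := by positivity
    have hns : (n : ℝ) + 1 = 1 / s := by rw [hs]; field_simp
    have h := hg.2 (Set.mem_univ t) (Set.mem_univ 0) (by positivity : 0 ≤ s / t)
      (by rw [sub_nonneg, div_le_one ht]; exact hn.le : 0 ≤ 1 - s / t) (by ring)
    have h0 : (s / t) • t + (1 - s / t) • 0 = s := by
      simp only [smul_eq_mul, mul_zero, add_zero]; field_simp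
    rw [h0] at h
    simp only [smul_eq_mul] at h
    have h1 : s * (g t - g 0) ≤ t * (g s - g 0) := by
      rw [mul_comm t, ← div_le_iff₀ ht]
      have : s * (g t - g 0) / t = s / t * g t + (1 - s / t) * g 0 - g 0 := by ring
      linarith
    have h2 : s * (g t - g 0) ≤ s * (t * upperSlope g) := by
      refine h1.trans ?_
      rw [hns] at hle
      have : g s - g 0 ≤ s * upperSlope g := by
        calc g s - g 0 = s * (1 / s * (g s - g 0)) := by field_simp
          _ ≤ _ := by gcongr
      nlinarith
    have := le_of_mul_le_mul_left h2 hs0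
    linarith

theorem ConcaveOn.abs_upperSlope_le {g : ℝ → ℝ} (hg : ConcaveOn ℝ Set.univ g) {h M : ℝ}
    (hh : 0 < h) (hM : ∀ t, |t| ≤ h → |g t| ≤ M) : |upperSlope g| ≤ 2 * M / h := by
  have h1 := hg.le_add_upperSlope_mul h
  have h2 := hg.le_add_upperSlope_mul (-h)
  have m1 := abs_le.1 (hM h (abs_of_pos hh).le)
  have m2 := abs_le.1 (hM (-h) (by rw [abs_neg, abs_of_pos hh]))
  have m3 := abs_le.1 (hM 0 (by simpa using hh.le))
  rw [abs_le, ← neg_div, div_le_iff₀ hh, le_div_iff₀ hh]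
  constructor <;> linarith

/-- The properties of a Bellman function which imply the inequality `‖v ∗ f‖_q ≤ C ‖f‖_q` for
transforms of martingales by predictable sequences with values in `[b, B]`. -/
structure IsBellmanFunction (q C b B : ℝ) (U : ℝ × ℝ → ℝ) : Prop where
  measurable : Measurable U
  growth : ∃ K, 0 ≤ K ∧ ∀ z, |U z| ≤ K * ‖z‖ ^ q
  majorant : ∀ z, |z.2| ^ q - C ^ q * |z.1| ^ q ≤ U z
  symm : ∀ z, U (-z) = U z
  concave : ∀ c ∈ Set.Icc b B, ∀ z, ConcaveOn ℝ Set.univ fun t : ℝ => U (z + t • ((1, c) : ℝ × ℝ))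

namespace IsBellmanFunction

variable {q C b B : ℝ} {U : ℝ × ℝ → ℝ}

/-- The point 0 is the midpoint of ±(x, cx), where U takes equal values by symmetry. Concavity
bounds that value by U(0), which is 0 by the growth condition. -/
theorem apply_mul_nonpos (hU : IsBellmanFunction q C b B U) (hq : 1 < q) {c : ℝ}
    (hc : c ∈ Set.Icc b B) (x : ℝ) : U (x, c * x) ≤ 0 := by
  obtain ⟨K, -, hK⟩ := hU.growth
  have h0 : U 0 = 0 := by
    have := hK 0
    rw [norm_zero, Real.zero_rpow (by linarith), mul_zero] at this
    exact abs_nonpos_iff.1 this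
  have h := (hU.concave c hc 0).2 (Set.mem_univ x) (Set.mem_univ (-x))
    (by norm_num : (0 : ℝ) ≤ 1 / 2) (by norm_num : (0 : ℝ) ≤ 1 / 2) (by norm_num)
  have h1 : (0 : ℝ × ℝ) + (-x) • ((1, c) : ℝ × ℝ) = -(x, c * x) := by ext <;> simp [mul_comm]
  have h2 : (0 : ℝ × ℝ) + x • ((1, c) : ℝ × ℝ) = (x, c * x) := by ext <;> simp [mul_comm]
  simp only [h1, h2, hU.symm] at h
  simp [h0] at h
  linarith

theorem exists_abs_upperSlope_le (hU : IsBellmanFunction q C b B U) (hq : 1 < q) :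
    ∃ L, 0 ≤ L ∧ ∀ z, ∀ c ∈ Set.Icc b B,
      |upperSlope fun t : ℝ => U (z + t • ((1, c) : ℝ × ℝ))| ≤ L * (1 + ‖z‖) ^ (q - 1) := by
  obtain ⟨K, hK0, hK⟩ := hU.growth
  set D : ℝ := 2 + |b| + |B| with hD
  have hD0 : 0 < D := by positivity
  refine ⟨2 * (K * D ^ q), by positivity, fun z c hc => ?_⟩
  have hh : 0 < 1 + ‖z‖ := by positivity
  -- On the window |t| ≤ 1 + ‖z‖ the function is O((1 + ‖z‖)^q); division by the window size leaves
  -- the exponent q - 1.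
  have h := (hU.concave c hc z).abs_upperSlope_le hh (M := K * (D ^ q * (1 + ‖z‖) ^ q))
    fun t ht => by
      refine (hK _).trans ?_
      rw [← Real.mul_rpow hD0.le hh.le]
      gcongr
      have h1 : ‖((1, c) : ℝ × ℝ)‖ ≤ 1 + |b| + |B| := by
        rw [Prod.norm_mk]
        refine max_le ?_ ?_
        · rw [norm_one]; linarith [abs_nonneg b, abs_nonneg B]
        · rw [Real.norm_eq_abs, abs_le]
          constructor
          · linarith [hc.1, neg_abs_le b, abs_nonneg B]
          · linarith [hc.2, le_abs_self B, abs_nonneg b]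
      calc _ ≤ ‖z‖ + |t| * ‖((1, c) : ℝ × ℝ)‖ := by
            refine (norm_add_le _ _).trans ?_
            rw [norm_smul, Real.norm_eq_abs]
        _ ≤ (1 + ‖z‖) + (1 + ‖z‖) * (1 + |b| + |B|) := by gcongr; linarith
        _ = D * (1 + ‖z‖) := by rw [hD]; ring
  refine h.trans (le_of_eq ?_)
  rw [Real.rpow_sub hh, Real.rpow_one]
  ring

end IsBellmanFunction

theorem rpow_sub_one_mul_le {q a d : ℝ} (hq : 1 < q) (ha : 0 < a) (hd : 0 ≤ d) :
    a ^ (q - 1) * d ≤ a ^ q + d ^ q := by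
  rcases le_total d a with h | h
  · calc a ^ (q - 1) * d ≤ a ^ (q - 1) * a := by gcongr
      _ = a ^ q := by rw [Real.rpow_sub ha, Real.rpow_one]; field_simp
      _ ≤ _ := by linarith [Real.rpow_nonneg hd q]
  · have hd0 : 0 < d := ha.trans_le h
    calc a ^ (q - 1) * d ≤ d ^ (q - 1) * d := by
          gcongr
      _ = d ^ q := by rw [Real.rpow_sub hd0, Real.rpow_one]; field_simp
      _ ≤ _ := by linarith [Real.rpow_nonneg ha.le q]

theorem mgTransform_succ {Ω : Type*} (v f : ℕ → Ω → ℝ) (n : ℕ) (ω : Ω) :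
    mgTransform v f (n + 1) ω = mgTransform v f n ω + v (n + 1) ω * (f (n + 1) ω - f n ω) := by
  simp only [mgTransform, Finset.sum_range_succ]
  ring

/-! ### Burkholder's method for martingale transforms -/

section Martingale

variable {Ω : Type*} {mΩ : MeasurableSpace Ω} {P : Measure Ω}
  {ℱ : Filtration ℕ mΩ} {f v : ℕ → Ω → ℝ} {b B : ℝ}

theorem measurable_mgTransform (hf : Martingale f ℱ P) (hv : ∀ k, Measurable[ℱ (k - 1)] (v k))
    (n : ℕ) : Measurable[ℱ n] (mgTransform v f n) := by
  have hfm : ∀ k ≤ n, Measurable[ℱ n] (f k) := fun k hk =>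
    ((hf.stronglyAdapted k).measurable).mono (ℱ.mono hk) le_rfl
  have hvm : ∀ k ≤ n + 1, Measurable[ℱ n] (v k) := fun k hk =>
    (hv k).mono (ℱ.mono (by omega)) le_rfl
  have h0 := (hvm 0 (by omega)).mul (hfm 0 (by omega))
  refine Measurable.add h0 ?_
  refine Finset.measurable_fun_sum _ fun k hk => ?_
  have hk' := Finset.mem_range.1 hk
  exact (hvm (k + 1) (by omega)).mul ((hfm (k + 1) (by omega)).sub (hfm k (by omega)))

theorem memLp_mgTransform (hv : ∀ k, Measurable[ℱ (k - 1)] (v k))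
    (hvb : ∀ k ω, v k ω ∈ Set.Icc b B) {p : ℝ≥0∞} {n : ℕ} (hfp : ∀ k ≤ n, MemLp (f k) p P) :
    MemLp (mgTransform v f n) p P := by
  have hvp : ∀ k, MemLp (v k) ∞ P := fun k => by
    refine memLp_top_of_bound (((hv k).mono (ℱ.le _) le_rfl).aestronglyMeasurable) (|b| + |B|)
      (ae_of_all _ fun ω => ?_)
    rw [Real.norm_eq_abs, abs_le]
    constructor
    · linarith [(hvb k ω).1, neg_abs_le b, abs_nonneg B]
    · linarith [(hvb k ω).2, le_abs_self B, abs_nonneg b]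
  induction n with
  | zero =>
    have : mgTransform v f 0 = v 0 * f 0 := by ext ω; simp [mgTransform]
    rw [this]
    exact (hfp 0 le_rfl).mul (hvp 0)
  | succ n ih =>
    have : mgTransform v f (n + 1) = mgTransform v f n + v (n + 1) * (f (n + 1) - f n) := by
      ext ω; exact mgTransform_succ v f n ω
    rw [this]
    exact (ih fun k hk => hfp k (by omega)).add
      (((hfp (n + 1) le_rfl).sub (hfp n (by omega))).mul (hvp (n + 1)))

theorem MeasureTheory.Martingale.integral_mul_sub_eq_zero [IsProbabilityMeasure P]
    (hf : Martingale f ℱ P) (k : ℕ)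
    {A : Ω → ℝ} (hAm : Measurable[ℱ k] A) (hAd : Integrable (A * (f (k + 1) - f k)) P) :
    ∫ ω, (A * (f (k + 1) - f k)) ω ∂P = 0 := by
  have hfi := hf.integrable
  have h1 := condExp_mul_of_stronglyMeasurable_left (m := ℱ k) (μ := P)
    hAm.stronglyMeasurable hAd ((hfi (k + 1)).sub (hfi k))
  have h2 : P[f (k + 1) - f k | ℱ k] =ᵐ[P] 0 := by
    have e1 := hf.condExp_ae_eq (Nat.le_succ k)
    have e2 := hf.condExp_ae_eq (le_refl k)
    filter_upwards [condExp_sub (hfi (k + 1)) (hfi k) (ℱ k), e1, e2] with ω w1 w2 w3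
    rw [w1, Pi.sub_apply, w3]
    simp only [Nat.succ_eq_add_one] at w2
    rw [w2, sub_self]; rfl
  rw [← integral_condExp (ℱ.le k), integral_congr_ae h1]
  refine integral_eq_zero_of_ae ?_
  filter_upwards [h2] with ω hω
  simp [hω]

theorem integrable_norm_rpow_of_memLp_ofReal {F : Type*} [NormedAddCommGroup F] {g : Ω → F}
    {q : ℝ} (hq : 0 < q) (hg : MemLp g (ENNReal.ofReal q) P) :
    Integrable (fun ω => ‖g ω‖ ^ q) P := by
  have := hg.integrable_norm_rpow (by simpa using hq) ENNReal.ofReal_ne_top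
  rwa [ENNReal.toReal_ofReal hq.le] at this

theorem IsBellmanFunction.integrable_comp {q C : ℝ} {U : ℝ × ℝ → ℝ} (hq : 1 < q)
    (hU : IsBellmanFunction q C b B U) {Z : Ω → ℝ × ℝ} (hZm : Measurable Z)
    (hZp : MemLp Z (ENNReal.ofReal q) P) : Integrable (fun ω => U (Z ω)) P := by
  obtain ⟨K, -, hK⟩ := hU.growth
  exact ((integrable_norm_rpow_of_memLp_ofReal (by linarith) hZp).const_mul K).mono'
    (hU.measurable.comp hZm).aestronglyMeasurable (ae_of_all _ fun ω => hK _)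

/-- A Bellman function of a martingale and its transform decreases in mean. -/
theorem IsBellmanFunction.integral_step_le [IsProbabilityMeasure P] {q C : ℝ} {U : ℝ × ℝ → ℝ}
    (hq : 1 < q) (hU : IsBellmanFunction q C b B U) (hf : Martingale f ℱ P) {k : ℕ}
    {Z : Ω → ℝ × ℝ} {c : Ω → ℝ} (hZm : Measurable[ℱ k] Z) (hZp : MemLp Z (ENNReal.ofReal q) P)
    (hc : Measurable[ℱ k] c) (hcb : ∀ ω, c ω ∈ Set.Icc b B)
    (hdp : MemLp (f (k + 1) - f k) (ENNReal.ofReal q) P)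
    (hUi : Integrable (fun ω => U (Z ω + (f (k + 1) ω - f k ω) • ((1, c ω) : ℝ × ℝ))) P) :
    ∫ ω, U (Z ω + (f (k + 1) ω - f k ω) • ((1, c ω) : ℝ × ℝ)) ∂P ≤ ∫ ω, U (Z ω) ∂P := by
  have hq0 : 0 < q := by linarith
  obtain ⟨L, hL0, hL⟩ := hU.exists_abs_upperSlope_le hq
  let A : Ω → ℝ := fun ω => upperSlope fun t : ℝ => U (Z ω + t • ((1, c ω) : ℝ × ℝ))
  -- The slope is a countable supremum of ℱ_k-measurable functions; this makes it a legitimate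
  -- factor in front of the martingale difference.
  have hAm : Measurable[ℱ k] A := by
    have hterm : ∀ t : ℝ, Measurable[ℱ k]
        fun ω => U (Z ω + t • ((1, c ω) : ℝ × ℝ)) := fun t =>
      hU.measurable.comp (hZm.add ((measurable_const.prodMk hc).const_smul t))
    exact Measurable.iSup fun j => ((hterm _).sub (hterm _)).const_mul _
  have hhp : MemLp (fun ω => 1 + ‖Z ω‖) (ENNReal.ofReal q) P :=
    (memLp_const (1 : ℝ)).add hZp.norm
  have hAd : Integrable (A * (f (k + 1) - f k)) P := by
    refine (((integrable_norm_rpow_of_memLp_ofReal hq0 hhp).add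
      (integrable_norm_rpow_of_memLp_ofReal hq0 hdp)).const_mul L).mono'
      ((hAm.mono (ℱ.le k) le_rfl).aestronglyMeasurable.mul hdp.1) (ae_of_all _ fun ω => ?_)
    have h1 : 0 < 1 + ‖Z ω‖ := by positivity
    have h2 := rpow_sub_one_mul_le hq h1 (norm_nonneg ((f (k + 1) - f k) ω))
    have h3 : ‖(1 + ‖Z ω‖)‖ = 1 + ‖Z ω‖ := Real.norm_of_nonneg h1.le
    rw [Pi.mul_apply, norm_mul, Pi.add_apply, h3]
    calc _ ≤ (L * (1 + ‖Z ω‖) ^ (q - 1)) * ‖(f (k + 1) - f k) ω‖ := by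
          gcongr
          exact hL _ _ (hcb _)
      _ ≤ _ := by rw [mul_assoc]; gcongr
  have hZi := hU.integrable_comp hq (hZm.mono (ℱ.le k) le_rfl) hZp
  -- The supporting line in the direction (1, c) bounds U after the step; its linear term has mean
  -- zero.
  calc _ ≤ ∫ ω, (U (Z ω) + (A * (f (k + 1) - f k)) ω) ∂P := by
        refine integral_mono hUi (hZi.add hAd) fun ω => ?_
        have h := (hU.concave (c ω) (hcb ω) (Z ω)).le_add_upperSlope_mul (f (k + 1) ω - f k ω)
        simp only [zero_smul, add_zero] at h
        exact h
    _ = _ := by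
      rw [integral_add hZi hAd, hf.integral_mul_sub_eq_zero k hAm hAd, add_zero]

/-- Burkholder's method. -/
theorem IsBellmanFunction.integral_mgTransform_le [IsProbabilityMeasure P] {q C : ℝ}
    {U : ℝ × ℝ → ℝ} (hq : 1 < q)
    (hU : IsBellmanFunction q C b B U) (hf : Martingale f ℱ P)
    (hv : ∀ k, Measurable[ℱ (k - 1)] (v k)) (hvb : ∀ k ω, v k ω ∈ Set.Icc b B) {n : ℕ}
    (hfn : MemLp (f n) (ENNReal.ofReal q) P) :
    ∫ ω, |mgTransform v f n ω| ^ q ∂P ≤ C ^ q * ∫ ω, |f n ω| ^ q ∂P := by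
  have hq0 : 0 < q := by linarith
  have hp1 : 1 ≤ ENNReal.ofReal q := by rw [← ENNReal.ofReal_one]; gcongr
  -- Earlier terms are conditional expectations of `f n`, so they inherit its integrability.
  have hfp : ∀ k ≤ n, MemLp (f k) (ENNReal.ofReal q) P := fun k hk =>
    (hfn.condExp hp1).ae_eq (hf.condExp_ae_eq hk)
  have hgp : ∀ k ≤ n, MemLp (mgTransform v f k) (ENNReal.ofReal q) P := fun k hk =>
    memLp_mgTransform hv hvb fun j hj => hfp j (hj.trans hk)
  have hZm : ∀ k, Measurable[ℱ k] fun ω => (f k ω, mgTransform v f k ω) := fun k =>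
    (hf.stronglyAdapted k).measurable.prodMk (measurable_mgTransform hf hv k)
  have hZm' : ∀ k, Measurable fun ω => (f k ω, mgTransform v f k ω) := fun k =>
    (hZm k).mono (ℱ.le k) le_rfl
  have hZp : ∀ k ≤ n, MemLp (fun ω => (f k ω, mgTransform v f k ω)) (ENNReal.ofReal q) P :=
    fun k hk => ((hfp k hk).norm.add (hgp k hk).norm).mono (hZm' k).aestronglyMeasurable
      (ae_of_all _ fun ω => by
        rw [Prod.norm_mk]
        refine (max_le_add_of_nonneg (norm_nonneg _) (norm_nonneg _)).trans ?_
        exact le_abs_self _)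
  have hUi : ∀ k ≤ n, Integrable (fun ω => U (f k ω, mgTransform v f k ω)) P := fun k hk =>
    hU.integrable_comp hq (hZm' k) (hZp k hk)
  have hstep : ∀ k, k + 1 ≤ n → ∫ ω, U (f (k + 1) ω, mgTransform v f (k + 1) ω) ∂P ≤
      ∫ ω, U (f k ω, mgTransform v f k ω) ∂P := by
    intro k hk
    have e : ∀ ω, (f (k + 1) ω, mgTransform v f (k + 1) ω) = (f k ω, mgTransform v f k ω) +
        (f (k + 1) ω - f k ω) • ((1, v (k + 1) ω) : ℝ × ℝ) := fun ω => by
      ext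
      · simp
      · simp only [mgTransform_succ, Prod.snd_add, Prod.smul_snd, smul_eq_mul]
        ring
    have hi := hUi (k + 1) hk
    simp only [e] at hi ⊢
    exact hU.integral_step_le hq hf (hZm k) (hZp k (by omega)) (hv (k + 1)) (hvb (k + 1))
      ((hfp _ hk).sub (hfp _ (by omega))) hi
  have hall : ∀ k ≤ n, ∫ ω, U (f k ω, mgTransform v f k ω) ∂P ≤ 0 := by
    intro k
    induction k with
    | zero =>
      intro _
      refine integral_nonpos fun ω => ?_
      have : mgTransform v f 0 ω = v 0 ω * f 0 ω := by simp [mgTransform]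
      simp only [this]
      exact hU.apply_mul_nonpos hq (hvb 0 ω) _
    | succ k ih => exact fun hk => (hstep k hk).trans (ih (by omega))
  have i1 : Integrable (fun ω => |mgTransform v f n ω| ^ q) P :=
    integrable_norm_rpow_of_memLp_ofReal hq0 (hgp n le_rfl)
  have i2 : Integrable (fun ω => |f n ω| ^ q) P := integrable_norm_rpow_of_memLp_ofReal hq0 hfn
  have hfin : ∫ ω, (|mgTransform v f n ω| ^ q - C ^ q * |f n ω| ^ q) ∂P ≤
      ∫ ω, U (f n ω, mgTransform v f n ω) ∂P :=
    integral_mono (i1.sub (i2.const_mul _)) (hUi n le_rfl) fun ω =>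
      hU.majorant (f n ω, mgTransform v f n ω)
  rw [integral_sub i1 (i2.const_mul _), integral_const_mul] at hfin
  linarith [hall n le_rfl]

/-- If a Bellman function exists, then the transform inequality holds. -/
theorem IsBellmanFunction.isTransformBound {q C : ℝ} {U : ℝ × ℝ → ℝ} (hq : 1 < q) (hC : 0 < C)
    (hU : IsBellmanFunction q C b B U) :
    IsTransformBound (ENNReal.ofReal q) b B (ENNReal.ofReal C) := by
  intro Ω mΩ P _ ℱ f v hf hv hvb
  have hq0 : 0 < q := by linarith
  have hp0 : ENNReal.ofReal q ≠ 0 := by simpa using hq0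
  have hpt : (ENNReal.ofReal q).toReal = q := ENNReal.toReal_ofReal hq0.le
  refine iSup_le fun n => ?_
  refine le_trans ?_ (mul_le_mul_right (le_iSup (fun n => eLpNorm (f n) (ENNReal.ofReal q) P) n) _)
  by_cases hfn : MemLp (f n) (ENNReal.ofReal q) P
  · have hfp : ∀ k ≤ n, MemLp (f k) (ENNReal.ofReal q) P := fun k hk =>
      (hfn.condExp (by rw [← ENNReal.ofReal_one]; gcongr)).ae_eq (hf.condExp_ae_eq hk)
    rw [(memLp_mgTransform hv hvb hfp).eLpNorm_eq_integral_rpow_norm hp0 ENNReal.ofReal_ne_top,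
      hfn.eLpNorm_eq_integral_rpow_norm hp0 ENNReal.ofReal_ne_top, hpt,
      ← ENNReal.ofReal_mul hC.le]
    refine ENNReal.ofReal_le_ofReal ?_
    have h := hU.integral_mgTransform_le hq hf hv hvb hfn
    have h0 : 0 ≤ ∫ ω, ‖f n ω‖ ^ q ∂P := integral_nonneg fun ω => by positivity
    calc _ ≤ (C ^ q * ∫ ω, ‖f n ω‖ ^ q ∂P) ^ q⁻¹ := by
          refine Real.rpow_le_rpow (integral_nonneg fun ω => by positivity) h (by positivity)
      _ = _ := by
          rw [Real.mul_rpow (by positivity) h0, Real.rpow_rpow_inv hC.le hq0.ne']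
  -- Here the right side is C · ∞, which is ∞ because C > 0.
  · have : eLpNorm (f n) (ENNReal.ofReal q) P = ∞ := by
      by_contra h
      exact hfn ⟨(hf.integrable n).1, lt_top_iff_ne_top.2 h⟩
    rw [this, ENNReal.mul_top (by simpa using hC)]
    exact le_top

end Martingale

/-! ### Lattice frequencies and frequency-localized functions on Euclidean space -/

section Transference

variable {d : ℕ}

/-- The point with integer coordinates `n` with respect to the orthonormal basis `e`. -/
noncomputable def latticeVec (e : OrthonormalBasis (Fin d) ℝ (EuclideanSpace ℝ (Fin d)))
    (n : Fin d → ℤ) : EuclideanSpace ℝ (Fin d) := ∑ j, (n j : ℝ) • e j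

/-- The map `u ↦ t u`, in coordinates with respect to `e` and modulo `ℤ^d`. -/
noncomputable def flatTorusMap (e : OrthonormalBasis (Fin d) ℝ (EuclideanSpace ℝ (Fin d))) (t : ℝ)
    (u : EuclideanSpace ℝ (Fin d)) : UnitAddTorus (Fin d) :=
  fun j => ((t * inner ℝ (e j) u : ℝ) : UnitAddCircle)

variable (e : OrthonormalBasis (Fin d) ℝ (EuclideanSpace ℝ (Fin d)))

theorem continuous_flatTorusMap (t : ℝ) : Continuous (flatTorusMap e t) := by
  refine continuous_pi fun j => ?_
  refine (AddCircle.continuous_mk' 1).comp ?_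
  fun_prop

theorem inner_latticeVec (n : Fin d → ℤ) (i : Fin d) : inner ℝ (e i) (latticeVec e n) = n i := by
  simp [latticeVec, inner_sum, real_inner_smul_right, e.inner_eq_ite]

theorem latticeVec_ne_zero {n : Fin d → ℤ} (hn : n ≠ 0) : latticeVec e n ≠ 0 := by
  obtain ⟨i, hi⟩ := Function.ne_iff.1 hn
  intro h
  have := inner_latticeVec e n i
  rw [h, inner_zero_right] at this
  exact hi (by exact_mod_cast this.symm)

theorem latticeVec_add (n k : Fin d → ℤ) :
    latticeVec e (n + k) = latticeVec e n + latticeVec e k := by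
  simp [latticeVec, add_smul, Finset.sum_add_distrib]

theorem latticeVec_zsmul (j : ℤ) (n : Fin d → ℤ) :
    latticeVec e (j • n) = (j : ℝ) • latticeVec e n := by
  simp [latticeVec, mul_smul, Finset.smul_sum]

theorem mFourier_flatTorusMap (n : Fin d → ℤ) (t : ℝ) (u : EuclideanSpace ℝ (Fin d)) :
    mFourier n (flatTorusMap e t u) = (Real.fourierChar (inner ℝ (t • latticeVec e n) u) : ℂ) := by
  rw [Real.fourierChar_apply]
  simp only [mFourier, ContinuousMap.coe_mk, flatTorusMap, fourier_coe_apply]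
  rw [← Complex.exp_sum]
  congr 1
  rw [latticeVec, real_inner_smul_left, sum_inner, Finset.mul_sum, Finset.mul_sum]
  push_cast
  rw [Finset.sum_mul]
  refine Finset.sum_congr rfl fun j _ => ?_
  rw [real_inner_smul_left]
  push_cast
  ring

/-- Averages against highly oscillating periodic functions converge to the mean value. -/
theorem tendsto_integral_flatTorusMap {w : EuclideanSpace ℝ (Fin d) → ℂ} (hw : Integrable w)
    (f : C(UnitAddTorus (Fin d), ℂ)) :
    Tendsto (fun N : ℕ => ∫ u, f (flatTorusMap e N u) * w u) atTop (𝓝 ((∫ u, w u) * ∫ x, f x)) := by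
  refine tendsto_of_tendsto_mFourier (fun N : ℕ => weightedIntegral volume (flatTorusMap e N)
    (continuous_flatTorusMap e N).measurable w hw) (∫ u, ‖w u‖)
    (fun N g => norm_weightedIntegral_le _ _ _ _ _ _) _ (fun n => ?_) f
  change Tendsto (fun N : ℕ => ∫ u, mFourier n (flatTorusMap e N u) * w u) atTop _
  by_cases hn : n = 0
  · subst hn
    simp [mFourier_zero]
  rw [integral_mFourier_eq_zero hn, mul_zero]
  have hco : Tendsto (fun N : ℕ => -((N : ℝ) • latticeVec e n)) atTop
      (cocompact (EuclideanSpace ℝ (Fin d))) := by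
    rw [← Metric.cobounded_eq_cocompact, ← tendsto_norm_atTop_iff_cobounded]
    simp only [norm_neg, norm_smul, Real.norm_natCast]
    exact tendsto_natCast_atTop_atTop.atTop_mul_const
      (norm_pos_iff.2 (latticeVec_ne_zero e hn))
  -- For a nonzero frequency this is the Riemann–Lebesgue lemma.
  refine ((tendsto_integral_exp_inner_smul_cocompact w).comp hco).congr fun N => ?_
  refine integral_congr_ae (ae_of_all _ fun u => ?_)
  simp only [mFourier_flatTorusMap, inner_neg_right, neg_neg, Circle.smul_def, smul_eq_mul,
    real_inner_comm]

theorem tendsto_integral_flatTorusMap_real {w : EuclideanSpace ℝ (Fin d) → ℝ} (hw : Integrable w)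
    (f : C(UnitAddTorus (Fin d), ℝ)) :
    Tendsto (fun N : ℕ => ∫ u, f (flatTorusMap e N u) * w u) atTop (𝓝 ((∫ u, w u) * ∫ x, f x)) := by
  have h := tendsto_integral_flatTorusMap e hw.ofReal
    (⟨fun x => (f x : ℂ), by fun_prop⟩ : C(UnitAddTorus (Fin d), ℂ))
  simp only [ContinuousMap.coe_mk, Complex.coe_algebraMap,
    ← Complex.ofReal_mul, integral_complex_ofReal] at h
  exact (Complex.continuous_re.tendsto _).comp h

/-- The product of `g` and the character `e^{2πi⟨a,u⟩}`. -/
noncomputable def modulated (g : 𝓢(EuclideanSpace ℝ (Fin d), ℂ)) (a : EuclideanSpace ℝ (Fin d)) :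
    𝓢(EuclideanSpace ℝ (Fin d), ℂ) :=
  𝓕⁻ (SchwartzMap.compSubConstCLM ℂ a (𝓕 g))

theorem modulated_apply (g : 𝓢(EuclideanSpace ℝ (Fin d), ℂ)) (a u : EuclideanSpace ℝ (Fin d)) :
    modulated g a u = (Real.fourierChar (inner ℝ a u) : ℂ) * g u := by
  have h : g u = (𝓕⁻ (𝓕 g)) u := by rw [FourierTransform.fourierInv_fourier_eq]
  rw [h, modulated, SchwartzMap.fourierInv_coe, SchwartzMap.fourierInv_coe, Real.fourierInv_eq,
    Real.fourierInv_eq, ← integral_const_mul,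
    ← integral_add_right_eq_self (μ := (volume : Measure (EuclideanSpace ℝ (Fin d)))) _ a]
  refine integral_congr_ae (ae_of_all _ fun v => ?_)
  simp only [SchwartzMap.compSubConstCLM_apply, add_sub_cancel_right, inner_add_left,
    Circle.smul_def, smul_eq_mul, AddChar.map_add_eq_mul, Circle.coe_mul]
  ring

theorem fourier_modulated (g : 𝓢(EuclideanSpace ℝ (Fin d), ℂ)) (a : EuclideanSpace ℝ (Fin d)) :
    𝓕 (modulated g a) = SchwartzMap.compSubConstCLM ℂ a (𝓕 g) :=
  FourierTransform.fourier_fourierInv_eq _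

variable {M : EuclideanSpace ℝ (Fin d) → ℂ} (hM : IsFourierMultiplier M)

theorem multiplierOp_add (f g : Lp ℂ 2 (volume : Measure (EuclideanSpace ℝ (Fin d)))) :
    multiplierOp M hM (f + g) = multiplierOp M hM f + multiplierOp M hM g := by
  simp only [multiplierOp]
  rw [FourierTransform.fourier_add, Lp.add_smul, FourierTransform.fourierInv_add]

theorem multiplierOp_smul (c : ℂ) (f : Lp ℂ 2 (volume : Measure (EuclideanSpace ℝ (Fin d)))) :
    multiplierOp M hM (c • f) = c • multiplierOp M hM f := by
  simp only [multiplierOp]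
  rw [FourierTransform.fourier_smul, ← Lp.smul_comm, FourierTransform.fourierInv_smul]

theorem fourier_multiplierOp (f : Lp ℂ 2 (volume : Measure (EuclideanSpace ℝ (Fin d)))) :
    𝓕 (multiplierOp M hM f) =
      (hM.memLp.toLp • 𝓕 f : Lp ℂ 2 (volume : Measure (EuclideanSpace ℝ (Fin d)))) :=
  FourierTransform.fourier_fourierInv_eq _

theorem Lp_two_fourier_sub (f g : Lp ℂ 2 (volume : Measure (EuclideanSpace ℝ (Fin d)))) :
    𝓕 (f - g) = 𝓕 f - 𝓕 g :=
  (Lp.fourierTransformₗᵢ (EuclideanSpace ℝ (Fin d)) ℂ).map_sub f g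

theorem Lp_two_norm_sq {α : Type*} [MeasurableSpace α] {μ : Measure α} (f : Lp ℂ 2 μ) :
    ‖f‖ ^ 2 = ∫ a, ‖f a‖ ^ 2 ∂μ := by
  have h := (Lp.memLp f).eLpNorm_eq_integral_rpow_norm two_ne_zero ENNReal.ofNat_ne_top
  have h0 : 0 ≤ ∫ a, ‖f a‖ ^ (2 : ℝ) ∂μ := integral_nonneg fun a => by positivity
  rw [Lp.norm_def, h, ENNReal.toReal_ofReal (by positivity)]
  simp only [ENNReal.toReal_ofNat]
  rw [← Real.rpow_natCast, Nat.cast_ofNat, Real.rpow_inv_rpow h0 two_ne_zero]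
  simp

theorem IsFourierMultiplier.exists_bound (hM : IsFourierMultiplier M) : ∃ K, 0 ≤ K ∧ ∀ ξ, ‖M ξ‖ ≤ K := by
  obtain ⟨K, hK⟩ := hM.bounded
  refine ⟨max K ‖M 0‖, le_max_of_le_right (norm_nonneg _), fun ξ => ?_⟩
  by_cases h : ξ = 0
  · rw [h]; exact le_max_right _ _
  · exact (hK ξ h).trans (le_max_left _ _)

/-- A homogeneous multiplier acts on functions which are localized in frequency near `N ξ` as the
multiplication by `M(ξ)`, in the limit `N → ∞`. -/
theorem tendsto_norm_multiplierOp_modulated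
    (hhom : ∀ ξ, ξ ≠ 0 → ∀ t : ℝ, 0 < t → M (t • ξ) = M ξ)
    {ξ : EuclideanSpace ℝ (Fin d)} (hξ : ξ ≠ 0) (hcont : ContinuousAt M ξ)
    (g : 𝓢(EuclideanSpace ℝ (Fin d), ℂ)) :
    Tendsto (fun N : ℕ => ‖multiplierOp M hM ((modulated g ((N : ℝ) • ξ)).toLp 2 volume) -
      M ξ • (modulated g ((N : ℝ) • ξ)).toLp 2 volume‖) atTop (𝓝 0) := by
  obtain ⟨K, hK0, hK⟩ := hM.exists_bound
  -- Plancherel, followed by a translation of the frequency variable by N ξ.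
  have hsq : ∀ N : ℕ, ‖multiplierOp M hM ((modulated g ((N : ℝ) • ξ)).toLp 2 volume) -
      M ξ • (modulated g ((N : ℝ) • ξ)).toLp 2 volume‖ ^ 2 =
      ∫ η, ‖(M ((2 * Real.pi) • (η + (N : ℝ) • ξ)) - M ξ) * (𝓕 g) η‖ ^ 2 := by
    intro N
    rw [← Lp.norm_fourier_eq, Lp_two_fourier_sub, FourierTransform.fourier_smul,
      fourier_multiplierOp, SchwartzMap.toLp_fourier_eq, fourier_modulated, Lp_two_norm_sq,
      ← integral_sub_right_eq_self (μ := volume) (fun η =>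
        ‖(M ((2 * Real.pi) • (η + (N : ℝ) • ξ)) - M ξ) *
          (𝓕 g : 𝓢(EuclideanSpace ℝ (Fin d), ℂ)) η‖ ^ 2) ((N : ℝ) • ξ)]
    refine integral_congr_ae ?_
    set G := SchwartzMap.compSubConstCLM ℂ ((N : ℝ) • ξ) (𝓕 g) with hG
    filter_upwards [Lp.coeFn_sub (hM.memLp.toLp • G.toLp 2 volume : Lp ℂ 2 _) (M ξ • G.toLp 2 volume),
      Lp.coeFn_lpSMul (r := 2) hM.memLp.toLp (G.toLp 2 volume), Lp.coeFn_smul (M ξ) (G.toLp 2 volume),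
      hM.memLp.coeFn_toLp, G.coeFn_toLp 2] with η h1 h2 h3 h4 h5
    rw [h1, Pi.sub_apply, h2, h3, Pi.smul_apply', Pi.smul_apply, h4, h5, hG,
      SchwartzMap.compSubConstCLM_apply, sub_add_cancel, smul_eq_mul, smul_eq_mul, sub_mul]
  have hlim : Tendsto (fun N : ℕ => ∫ η, ‖(M ((2 * Real.pi) • (η + (N : ℝ) • ξ)) - M ξ) *
      (𝓕 g) η‖ ^ 2) atTop (𝓝 0) := by
    have hint : Integrable fun η => ((2 * K) * ‖(𝓕 g) η‖) ^ 2 := by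
      have h2 := ((𝓕 g).memLp 2).integrable_norm_pow two_ne_zero
      simpa only [mul_pow _ ‖(𝓕 g) _‖] using h2.const_mul ((2 * K) ^ 2)
    have := tendsto_integral_of_dominated_convergence (F := fun (N : ℕ) η =>
      ‖(M ((2 * Real.pi) • (η + (N : ℝ) • ξ)) - M ξ) * (𝓕 g) η‖ ^ 2) (f := fun _ => (0 : ℝ))
      (fun η => ((2 * K) * ‖(𝓕 g) η‖) ^ 2) (fun N => ?_) hint (fun N => ae_of_all _ fun η => ?_)
      (ae_of_all _ fun η => ?_) (μ := (volume : Measure (EuclideanSpace ℝ (Fin d))))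
    · simpa using this
    · have hm1 : Measurable fun η => M ((2 * Real.pi) • (η + (N : ℝ) • ξ)) :=
        hM.measurable.comp (by fun_prop)
      exact (((hm1.sub_const _).mul (𝓕 g).continuous.measurable).norm.pow_const
        2).aestronglyMeasurable
    · rw [Real.norm_of_nonneg (by positivity), norm_mul]
      gcongr
      calc _ ≤ K + K := norm_sub_le_of_le (hK _) (hK _)
        _ = 2 * K := by ring
    · have hto : Tendsto (fun N : ℕ => ((N : ℝ)⁻¹ • η + ξ)) atTop (𝓝 ξ) := by
        have := (tendsto_inv_atTop_nhds_zero_nat (𝕜 := ℝ)).smul_const η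
        simpa using this.add_const ξ
      have h1 : Tendsto (fun N : ℕ => M ((2 * Real.pi) • (η + (N : ℝ) • ξ))) atTop
          (𝓝 (M ξ)) := by
        refine (hcont.tendsto.comp hto).congr' ?_
        filter_upwards [hto.eventually_ne hξ, eventually_gt_atTop 0] with N hN hN0
        have hN0' : (0 : ℝ) < N := by exact_mod_cast hN0
        -- Homogeneity discards the factor 2πN, so the normalization of the Fourier transform plays
        -- no role in the limit.
        have : (2 * Real.pi) • (η + (N : ℝ) • ξ) = (2 * Real.pi * N) • ((N : ℝ)⁻¹ • η + ξ) := by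
          rw [smul_add, smul_add, smul_smul, smul_smul]
          congr 2
          field_simp
        rw [Function.comp_apply, this, hhom _ hN _ (by positivity)]
      have h2 := (((h1.sub_const (M ξ)).mul_const ((𝓕 g) η)).norm).pow 2
      simpa using h2
  have hs := hlim.sqrt
  rw [Real.sqrt_zero] at hs
  refine hs.congr fun N => ?_
  rw [← hsq, Real.sqrt_sq (norm_nonneg _)]

end Transference

/-! ### Passage of the L^q bound to the torus -/

section Transference

/-- Bernoulli's inequality for ‖x‖/‖y‖, that is, the tangent line of the power at ‖y‖. -/
theorem rpow_norm_le_add {F : Type*} [NormedAddCommGroup F] {q : ℝ} (hq : 1 < q) (x y : F) :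
    ‖y‖ ^ q ≤ ‖x‖ ^ q + q * (‖y‖ ^ (q - 1) * ‖x - y‖) := by
  rcases (norm_nonneg y).eq_or_lt with h0 | h0
  · rw [← h0, Real.zero_rpow (by linarith)]
    positivity
  · have hb := one_add_mul_self_le_rpow_one_add (s := ‖x‖ / ‖y‖ - 1)
      (by linarith [div_nonneg (norm_nonneg x) h0.le]) hq.le
    rw [add_sub_cancel, Real.div_rpow (norm_nonneg _) h0.le, le_div_iff₀ (by positivity)] at hb
    have h1 : ‖y‖ - ‖x‖ ≤ ‖x - y‖ := by
      rw [norm_sub_rev]; exact norm_sub_norm_le y x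
    have h2 : ‖y‖ ^ (q - 1) = ‖y‖ ^ q / ‖y‖ := by rw [Real.rpow_sub h0, Real.rpow_one]
    have h3 : (1 + q * (‖x‖ / ‖y‖ - 1)) * ‖y‖ ^ q
        = ‖y‖ ^ q - q * (‖y‖ ^ (q - 1) * (‖y‖ - ‖x‖)) := by
      rw [h2]; field_simp; ring
    rw [h3] at hb
    have h4 : q * (‖y‖ ^ (q - 1) * (‖y‖ - ‖x‖)) ≤ q * (‖y‖ ^ (q - 1) * ‖x - y‖) := by
      gcongr
    linarith

/-- The multiplier approximation converges only in L², whereas the bound concerns L^q. The tangent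
inequality puts the power q - 1 on Y alone, so with a dominating function `k` for Y the
Cauchy–Schwarz inequality makes L² closeness sufficient. -/
theorem integral_rpow_norm_le_of_Lp_two {α : Type*} [MeasurableSpace α] {μ : Measure α} {q : ℝ}
    (hq : 1 < q) (X Y : Lp ℂ 2 μ) (hX : Integrable (fun a => ‖X a‖ ^ q) μ)
    (hY : Integrable (fun a => ‖Y a‖ ^ q) μ) {k : α → ℝ} (hk : ∀ᵐ a ∂μ, ‖Y a‖ ≤ k a)
    (hk2 : MemLp (fun a => k a ^ (q - 1)) 2 μ) :
    ∫ a, ‖Y a‖ ^ q ∂μ ≤ ∫ a, ‖X a‖ ^ q ∂μ +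
      q * (√(∫ a, (k a ^ (q - 1)) ^ 2 ∂μ) * ‖X - Y‖) := by
  have hE : MemLp (fun a => ‖(X - Y) a‖) 2 μ := (Lp.memLp (X - Y)).norm
  have hi : Integrable (fun a => k a ^ (q - 1) * ‖(X - Y) a‖) μ := hk2.integrable_mul hE
  have h1 : ∫ a, ‖Y a‖ ^ q ∂μ ≤ ∫ a, (‖X a‖ ^ q + q * (k a ^ (q - 1) * ‖(X - Y) a‖)) ∂μ := by
    refine integral_mono_ae hY (hX.add (hi.const_mul q)) ?_
    filter_upwards [hk, Lp.coeFn_sub X Y] with a ha hXY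
    rw [hXY, Pi.sub_apply]
    refine (rpow_norm_le_add hq (X a) (Y a)).trans ?_
    gcongr
  rw [integral_add hX (hi.const_mul q), integral_const_mul] at h1
  refine h1.trans ?_
  have hk0 : ∀ᵐ a ∂μ, 0 ≤ k a ^ (q - 1) := by
    filter_upwards [hk] with a ha
    exact Real.rpow_nonneg ((norm_nonneg _).trans ha) _
  have h2 := integral_mul_le_Lp_mul_Lq_of_nonneg (μ := μ) Real.HolderConjugate.two_two
    (f := fun a => k a ^ (q - 1)) (g := fun a => ‖(X - Y) a‖) hk0
    (ae_of_all _ fun a => norm_nonneg _) (by simpa using hk2) (by simpa using hE)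
  simp only [Real.rpow_two, ← Real.sqrt_eq_rpow] at h2
  rw [← Lp_two_norm_sq (X - Y), Real.sqrt_sq (norm_nonneg _)] at h2
  gcongr

variable {d : ℕ} (e : OrthonormalBasis (Fin d) ℝ (EuclideanSpace ℝ (Fin d)))
  {m : EuclideanSpace ℝ (Fin d) → ℝ} (hm : IsFourierMultiplier (fun ξ => (m ξ : ℂ)))

/-- Symbol pairs on the torus are limits of pairs `(f, T_m f)` on the Euclidean space. -/
theorem exists_transference_sequence (hcont : ContinuousOn m {0}ᶜ)
    (hhom : ∀ ξ, ξ ≠ 0 → ∀ t : ℝ, 0 < t → m (t • ξ) = m ξ)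
    (g : 𝓢(EuclideanSpace ℝ (Fin d), ℂ)) {w : C(UnitAddTorus (Fin d), ℂ × ℂ)}
    (hw : w ∈ symbolPairs fun n => m (latticeVec e n)) :
    ∃ F H : ℕ → Lp ℂ 2 (volume : Measure (EuclideanSpace ℝ (Fin d))),
      (∀ N, F N =ᵐ[volume] fun u => (w (flatTorusMap e N u)).1 * g u) ∧
      (∀ N, H N =ᵐ[volume] fun u => (w (flatTorusMap e N u)).2 * g u) ∧
      Tendsto (fun N => ‖multiplierOp _ hm (F N) - H N‖) atTop (𝓝 0) := by
  induction hw using Submodule.span_induction with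
  | mem w hw =>
    obtain ⟨n, hn, rfl⟩ := hw
    have hξ := latticeVec_ne_zero e hn
    have hco : ContinuousAt (fun ξ => (m ξ : ℂ)) (latticeVec e n) :=
      Complex.continuous_ofReal.continuousAt.comp
        (hcont.continuousAt (isOpen_compl_singleton.mem_nhds hξ))
    have hgm : ∀ N : ℕ, ((modulated g ((N : ℝ) • latticeVec e n)).toLp 2 volume) =ᵐ[volume]
        fun u => mFourier n (flatTorusMap e N u) * g u := fun N => by
      filter_upwards [(modulated g ((N : ℝ) • latticeVec e n)).coeFn_toLp 2 volume] with u hu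
      rw [hu, modulated_apply, mFourier_flatTorusMap]
    refine ⟨_, _, hgm, fun N => ?_, tendsto_norm_multiplierOp_modulated hm
      (fun ξ hξ t ht => by simp only [hhom ξ hξ t ht]) hξ hco g⟩
    filter_upwards [Lp.coeFn_smul (m (latticeVec e n) : ℂ)
      ((modulated g ((N : ℝ) • latticeVec e n)).toLp 2 volume), hgm N] with u h1 h2
    rw [h1, Pi.smul_apply, h2, smul_eq_mul, ← mul_assoc]
    rfl
  | zero =>
    refine ⟨fun _ => 0, fun _ => 0, fun N => ?_, fun N => ?_, ?_⟩
    · filter_upwards [Lp.coeFn_zero ℂ 2 (volume : Measure (EuclideanSpace ℝ (Fin d)))] with u hu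
      simp
    · filter_upwards [Lp.coeFn_zero ℂ 2 (volume : Measure (EuclideanSpace ℝ (Fin d)))] with u hu
      simp
    · have : multiplierOp _ hm 0 = 0 := by simpa using multiplierOp_smul hm 0 0
      simp only [this, sub_zero, norm_zero]
      exact tendsto_const_nhds
  | add w w' _ _ h h' =>
    obtain ⟨F, H, hF, hH, hlim⟩ := h
    obtain ⟨F', H', hF', hH', hlim'⟩ := h'
    refine ⟨fun N => F N + F' N, fun N => H N + H' N, fun N => ?_, fun N => ?_, ?_⟩
    · filter_upwards [Lp.coeFn_add (F N) (F' N), hF N, hF' N] with u h1 h2 h3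
      rw [h1, Pi.add_apply, h2, h3, ContinuousMap.add_apply, Prod.fst_add, add_mul]
    · filter_upwards [Lp.coeFn_add (H N) (H' N), hH N, hH' N] with u h1 h2 h3
      rw [h1, Pi.add_apply, h2, h3, ContinuousMap.add_apply, Prod.snd_add, add_mul]
    · refine squeeze_zero (fun N => norm_nonneg _) (fun N => ?_) (by simpa using hlim.add hlim')
      rw [multiplierOp_add, add_sub_add_comm]
      exact norm_add_le _ _
  | smul a w _ h =>
    obtain ⟨F, H, hF, hH, hlim⟩ := h
    refine ⟨fun N => a • F N, fun N => a • H N, fun N => ?_, fun N => ?_, ?_⟩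
    · filter_upwards [Lp.coeFn_smul a (F N), hF N] with u h1 h2
      rw [h1, Pi.smul_apply, h2, ContinuousMap.smul_apply, Prod.smul_fst, smul_eq_mul,
        smul_eq_mul, mul_assoc]
    · filter_upwards [Lp.coeFn_smul a (H N), hH N] with u h1 h2
      rw [h1, Pi.smul_apply, h2, ContinuousMap.smul_apply, Prod.smul_snd, smul_eq_mul,
        smul_eq_mul, mul_assoc]
    · have := hlim.const_mul ‖a‖
      rw [mul_zero] at this
      refine this.congr fun N => ?_
      rw [multiplierOp_smul, ← smul_sub, norm_smul]

theorem exists_compactly_supported_schwartz (d : ℕ) :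
    ∃ g : 𝓢(EuclideanSpace ℝ (Fin d), ℂ), HasCompactSupport g ∧ g 0 ≠ 0 := by
  let β : ContDiffBump (0 : EuclideanSpace ℝ (Fin d)) := ⟨1, 2, one_pos, one_lt_two⟩
  have h1 : HasCompactSupport fun u => (β u : ℂ) :=
    β.hasCompactSupport.comp_left (g := fun x : ℝ => (x : ℂ)) Complex.ofReal_zero
  have h2 : ContDiff ℝ (⊤ : ℕ∞) fun u => (β u : ℂ) :=
    Complex.ofRealCLM.contDiff.comp β.contDiff
  refine ⟨h1.toSchwartzMap h2, h1, ?_⟩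
  change (β 0 : ℂ) ≠ 0
  rw [β.one_of_mem_closedBall (by simp [β])]
  simp

/-- Transference from the Euclidean space to the torus. -/
theorem integral_rpow_symbolPairs_le (hcont : ContinuousOn m {0}ᶜ)
    (hhom : ∀ ξ, ξ ≠ 0 → ∀ t : ℝ, 0 < t → m (t • ξ) = m ξ) {q C : ℝ} (hq : 1 < q) (hC : 0 ≤ C)
    (hT : ∀ f : Lp ℂ 2 (volume : Measure (EuclideanSpace ℝ (Fin d))),
      MemLp f (ENNReal.ofReal q) volume → eLpNorm (multiplierOp _ hm f) (ENNReal.ofReal q) volume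
        ≤ ENNReal.ofReal C * eLpNorm f (ENNReal.ofReal q) volume)
    {w : C(UnitAddTorus (Fin d), ℂ × ℂ)} (hw : w ∈ symbolPairs fun n => m (latticeVec e n)) :
    ∫ t, ‖(w t).2‖ ^ q ≤ C ^ q * ∫ t, ‖(w t).1‖ ^ q := by
  have hq0 : 0 < q := by linarith
  -- Compact support gives |g|^q integrable and |g|^(q-1) in L², for every q > 1.
  obtain ⟨g, hgc, hg0⟩ := exists_compactly_supported_schwartz d
  obtain ⟨F, H, hF, hH, hlim⟩ := exists_transference_sequence e hm hcont hhom g hw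
  have hgq : Continuous fun u => ‖g u‖ ^ q := continuous_rpow_norm hq0.le g.continuous
  have hgqc : HasCompactSupport fun u => ‖g u‖ ^ q :=
    hgc.comp_left (g := fun z : ℂ => ‖z‖ ^ q) (by simp [hq0.ne'])
  have hgi : Integrable fun u => ‖g u‖ ^ q := hgq.integrable_of_hasCompactSupport hgqc
  have hG : 0 < ∫ u, ‖g u‖ ^ q := by
    refine hgq.integral_pos_of_hasCompactSupport_nonneg_nonzero hgqc (fun u => by positivity)
      (x := 0) ?_
    have : 0 < ‖g 0‖ := norm_pos_iff.2 hg0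
    positivity
  have hgp : MemLp g (ENNReal.ofReal q) volume :=
    g.continuous.memLp_of_hasCompactSupport hgc
  have hw1 : ∀ t, ‖(w t).1‖ ≤ ‖w‖ := fun t => (norm_fst_le _).trans (w.norm_coe_le_norm t)
  have hw2 : ∀ t, ‖(w t).2‖ ≤ ‖w‖ := fun t => (norm_snd_le _).trans (w.norm_coe_le_norm t)
  have hFp : ∀ N, MemLp (F N) (ENNReal.ofReal q) volume := fun N => by
    refine (hgp.const_mul (‖w‖ : ℂ)).mono (Lp.aestronglyMeasurable _) ?_
    filter_upwards [hF N] with u hu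
    rw [hu, norm_mul, norm_mul, Complex.norm_real, norm_norm]
    gcongr
    exact hw1 _
  have hHb : ∀ N, ∀ᵐ u, ‖H N u‖ ≤ ‖w‖ * ‖g u‖ := fun N => by
    filter_upwards [hH N] with u hu
    rw [hu, norm_mul]
    gcongr
    exact hw2 _
  have hHp : ∀ N, MemLp (H N) (ENNReal.ofReal q) volume := fun N => by
    refine (hgp.const_mul (‖w‖ : ℂ)).mono (Lp.aestronglyMeasurable _) ?_
    filter_upwards [hHb N] with u hu
    rwa [norm_mul, Complex.norm_real, norm_norm]
  have hk2 : MemLp (fun u => (‖w‖ * ‖g u‖) ^ (q - 1)) 2 volume := by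
    have hq1 : q - 1 ≠ 0 := by linarith
    have hc : Continuous fun u => (‖w‖ * ‖g u‖) ^ (q - 1) :=
      (Real.continuous_rpow_const (by linarith)).comp (g.continuous.norm.const_mul _)
    exact hc.memLp_of_hasCompactSupport
      (hgc.comp_left (g := fun z : ℂ => (‖w‖ * ‖z‖) ^ (q - 1)) (by simp [hq1]))
  have hTp : ∀ N, MemLp (multiplierOp _ hm (F N)) (ENNReal.ofReal q) volume := fun N =>
    ⟨Lp.aestronglyMeasurable _, (hT _ (hFp N)).trans_lt
      (ENNReal.mul_lt_top ENNReal.ofReal_lt_top (hFp N).2)⟩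
  have hTF : ∀ N, ∫ u, ‖multiplierOp _ hm (F N) u‖ ^ q ≤ C ^ q * ∫ u, ‖F N u‖ ^ q := fun N => by
    have h := hT _ (hFp N)
    have hp0 : ENNReal.ofReal q ≠ 0 := by simpa using hq0
    have i1 : 0 ≤ ∫ u, ‖multiplierOp _ hm (F N) u‖ ^ q := integral_nonneg fun u => by positivity
    have i2 : 0 ≤ ∫ u, ‖F N u‖ ^ q := integral_nonneg fun u => by positivity
    rw [(hTp N).eLpNorm_eq_integral_rpow_norm hp0 ENNReal.ofReal_ne_top,
      (hFp N).eLpNorm_eq_integral_rpow_norm hp0 ENNReal.ofReal_ne_top,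
      ENNReal.toReal_ofReal hq0.le, ← ENNReal.ofReal_mul hC,
      ENNReal.ofReal_le_ofReal_iff (by positivity)] at h
    have h' := Real.rpow_le_rpow (by positivity) h hq0.le
    rwa [Real.mul_rpow hC (by positivity), Real.rpow_inv_rpow i1 hq0.ne',
      Real.rpow_inv_rpow i2 hq0.ne'] at h'
  have hmain : ∀ N, ∫ u, ‖H N u‖ ^ q ≤ C ^ q * (∫ u, ‖F N u‖ ^ q) +
      q * (√(∫ u, ((‖w‖ * ‖g u‖) ^ (q - 1)) ^ 2) * ‖multiplierOp _ hm (F N) - H N‖) := fun N =>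
    (integral_rpow_norm_le_of_Lp_two hq _ _ (integrable_norm_rpow_of_memLp_ofReal hq0 (hTp N))
      (integrable_norm_rpow_of_memLp_ofReal hq0 (hHp N)) (hHb N) hk2).trans
      (add_le_add_left (hTF N) _)
  have hlimF : Tendsto (fun N => ∫ u, ‖F N u‖ ^ q) atTop
      (𝓝 ((∫ u, ‖g u‖ ^ q) * ∫ t, ‖(w t).1‖ ^ q)) := by
    refine (tendsto_integral_flatTorusMap_real e hgi
      ⟨fun t => ‖(w t).1‖ ^ q, continuous_rpow_norm hq0.le (by fun_prop)⟩).congr fun N => ?_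
    refine integral_congr_ae ?_
    filter_upwards [hF N] with u hu
    rw [hu, norm_mul, Real.mul_rpow (norm_nonneg _) (norm_nonneg _)]
    rfl
  have hlimH : Tendsto (fun N => ∫ u, ‖H N u‖ ^ q) atTop
      (𝓝 ((∫ u, ‖g u‖ ^ q) * ∫ t, ‖(w t).2‖ ^ q)) := by
    refine (tendsto_integral_flatTorusMap_real e hgi
      ⟨fun t => ‖(w t).2‖ ^ q, continuous_rpow_norm hq0.le (by fun_prop)⟩).congr fun N => ?_
    refine integral_congr_ae ?_
    filter_upwards [hH N] with u hu
    rw [hu, norm_mul, Real.mul_rpow (norm_nonneg _) (norm_nonneg _)]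
    rfl
  -- In the limit both sides carry the same positive factor ∫ |g|^q, which cancels.
  have hfinal := le_of_tendsto_of_tendsto' hlimH
    ((hlimF.const_mul (C ^ q)).add ((hlim.const_mul _).const_mul q)) hmain
  rw [mul_zero, mul_zero, add_zero, mul_left_comm] at hfinal
  exact le_of_mul_le_mul_left hfinal hG

end Transference

/-! ### The symbol on the lattice and its Bellman function -/

section Symbol

variable {d : ℕ} {m : EuclideanSpace ℝ (Fin d) → ℝ}
  (e : OrthonormalBasis (Fin d) ℝ (EuclideanSpace ℝ (Fin d)))

theorem tendsto_symbol_add_zsmul (hcont : ContinuousOn m {0}ᶜ)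
    (hhom : ∀ ξ, ξ ≠ 0 → ∀ t : ℝ, 0 < t → m (t • ξ) = m ξ) {n : Fin d → ℤ} (hn : n ≠ 0)
    (l : Fin d → ℤ) :
    Tendsto (fun N : ℕ => m (latticeVec e (l + (N : ℤ) • n))) atTop (𝓝 (m (latticeVec e n))) := by
  have hξ := latticeVec_ne_zero e hn
  have hco : ContinuousAt m (latticeVec e n) :=
    hcont.continuousAt (isOpen_compl_singleton.mem_nhds hξ)
  have hto : Tendsto (fun N : ℕ => ((N : ℝ)⁻¹ • latticeVec e l + latticeVec e n)) atTop
      (𝓝 (latticeVec e n)) := by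
    have := (tendsto_inv_atTop_nhds_zero_nat (𝕜 := ℝ)).smul_const (latticeVec e l)
    simpa using this.add_const (latticeVec e n)
  refine (hco.tendsto.comp hto).congr' ?_
  filter_upwards [hto.eventually_ne hξ, eventually_gt_atTop 0] with N hN hN0
  have hN0' : (0 : ℝ) < N := by exact_mod_cast hN0
  rw [Function.comp_apply, ← hhom _ hN N hN0', smul_add, smul_smul, mul_inv_cancel₀ hN0'.ne',
    one_smul, latticeVec_add, latticeVec_zsmul, Int.cast_natCast]

theorem symbol_zsmul (heven : ∀ ξ, ξ ≠ 0 → m (-ξ) = m ξ)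
    (hhom : ∀ ξ, ξ ≠ 0 → ∀ t : ℝ, 0 < t → m (t • ξ) = m ξ) {n : Fin d → ℤ} (hn : n ≠ 0) {j : ℤ}
    (hj : j ≠ 0) : m (latticeVec e (j • n)) = m (latticeVec e n) := by
  have hξ := latticeVec_ne_zero e hn
  rw [latticeVec_zsmul]
  rcases lt_or_gt_of_ne hj with h | h
  · have hj' : (0 : ℝ) < -(j : ℝ) := by
      have : (j : ℝ) < 0 := by exact_mod_cast h
      linarith
    -- Homogeneity covers positive multiples only; evenness supplies the negative ones.
    rw [← heven _ (smul_ne_zero (by exact_mod_cast hj) hξ), ← neg_smul, hhom _ hξ _ hj']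
  · exact hhom _ hξ _ (by exact_mod_cast h)

theorem latticeVec_single (i : Fin d) (k : ℤ) : latticeVec e (Pi.single i k) = (k : ℝ) • e i := by
  rw [latticeVec, Finset.sum_eq_single i]
  · rw [Pi.single_eq_same]
  · intro j _ hj
    rw [Pi.single_eq_of_ne hj, Int.cast_zero, zero_smul]
  · simp

/-- The values of the symbol at rational points are dense between its least and its greatest value
at the vectors of the basis. -/
theorem mem_closure_symbol [Nonempty (Fin d)] (hcont : ContinuousOn m {0}ᶜ)
    (hhom : ∀ ξ, ξ ≠ 0 → ∀ t : ℝ, 0 < t → m (t • ξ) = m ξ) {c : ℝ}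
    (hc : c ∈ Set.Icc (⨅ j, m (e j)) (⨆ j, m (e j))) :
    c ∈ closure ((fun n => m (latticeVec e n)) '' {0}ᶜ) := by
  obtain ⟨i, hi⟩ := exists_eq_ciInf_of_finite (f := fun j => m (e j))
  obtain ⟨j, hj⟩ := exists_eq_ciSup_of_finite (f := fun j => m (e j))
  rw [← hi, ← hj] at hc
  by_cases hij : i = j
  · subst hij
    refine subset_closure ⟨Pi.single i 1, ?_, ?_⟩
    · simp
    · simp only [latticeVec_single, Int.cast_one, one_smul]
      exact le_antisymm hc.1 hc.2
  -- The line through `e i` and `e j` avoids the origin, so m is continuous on it and takes the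
  -- value c. Its points with rational parameter are positive multiples of lattice points after
  -- clearing the denominator.
  let γ : ℝ → EuclideanSpace ℝ (Fin d) := fun t => (1 - t) • e i + t • e j
  have hγ0 : ∀ t, γ t ≠ 0 := by
    intro t ht
    have h1 : inner ℝ (e i) (γ t) = 1 - t := by
      simp [γ, inner_add_right, real_inner_smul_right, e.inner_eq_ite, hij]
    have h2 : inner ℝ (e j) (γ t) = t := by
      simp [γ, inner_add_right, real_inner_smul_right, e.inner_eq_ite, Ne.symm hij]
    rw [ht, inner_zero_right] at h1 h2
    linarith
  have hγ : Continuous γ := by fun_prop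
  have hmγ : Continuous fun t => m (γ t) :=
    hcont.comp_continuous hγ hγ0
  obtain ⟨t, ht⟩ : c ∈ Set.range fun t => m (γ t) :=
    mem_range_of_exists_le_of_exists_ge hmγ ⟨0, by simpa [γ] using hc.1⟩ ⟨1, by simpa [γ] using hc.2⟩
  rw [← ht]
  refine map_mem_closure (f := fun t => m (γ t)) hmγ (Rat.denseRange_cast (𝕜 := ℝ) t) ?_
  rintro _ ⟨r, rfl⟩
  have hden : (0 : ℝ) < r.den := by exact_mod_cast r.den_pos
  let n : Fin d → ℤ := Pi.single i ((r.den : ℤ) - r.num) + Pi.single j r.num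
  have hn : latticeVec e n = (r.den : ℝ) • γ r := by
    have hr : (r.den : ℝ) * (r : ℝ) = r.num := by
      have h : (r.den : ℚ) * r = r.num := by rw [mul_comm]; exact Rat.mul_den_eq_num r
      exact_mod_cast congrArg (fun x : ℚ => (x : ℝ)) h
    simp only [n, γ, latticeVec_add, latticeVec_single, smul_add, smul_smul, mul_sub, hr]
    push_cast
    rw [mul_one]
  refine ⟨n, ?_, ?_⟩
  · intro h0
    rw [Set.mem_singleton_iff] at h0
    rw [h0] at hn
    refine smul_ne_zero hden.ne' (hγ0 r) (hn.symm.trans ?_)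
    simp [latticeVec]
  · simp only [hn]
    exact hhom _ (hγ0 r) _ hden

/-- The Bellman function of a multiplier on the torus is a Bellman function for martingale
transforms. -/
theorem isBellmanFunction_bellman [Nonempty (Fin d)] (hcont : ContinuousOn m {0}ᶜ)
    (heven : ∀ ξ, ξ ≠ 0 → m (-ξ) = m ξ)
    (hhom : ∀ ξ, ξ ≠ 0 → ∀ t : ℝ, 0 < t → m (t • ξ) = m ξ) {q C C' : ℝ} (hq : 1 < q)
    (hC : 0 ≤ C) (hCC' : C < C')
    (hT : ∀ w ∈ symbolPairs fun n => m (latticeVec e n),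
      ∫ t, ‖(w t).2‖ ^ q ≤ C ^ q * ∫ t, ‖(w t).1‖ ^ q) :
    IsBellmanFunction q C' (⨅ j, m (e j)) (⨆ j, m (e j))
      fun z => bellman q C' (fun n => m (latticeVec e n)) ((z.1 : ℂ), (z.2 : ℂ)) := by
  have hq0 : 0 ≤ q := by linarith
  obtain ⟨K, hK0, hK⟩ := exists_bellmanMean_le hq hC hCC' hT
  have hbdd : ∀ z, BddAbove (Set.range fun w : symbolPairs fun n => m (latticeVec e n) =>
      bellmanMean q C' w.1 z) := by
    intro z
    refine ⟨K * ‖z‖ ^ q, ?_⟩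
    rintro _ ⟨w, rfl⟩
    exact hK w.1 w.2 z
  have hmaj : ∀ z : ℝ × ℝ, |z.2| ^ q - C' ^ q * |z.1| ^ q ≤
      bellman q C' (fun n => m (latticeVec e n)) ((z.1 : ℂ), (z.2 : ℂ)) := fun z => by
    have := powerGap_le_bellman hbdd ((z.1 : ℂ), (z.2 : ℂ))
    simpa [powerGap] using this
  have hC'q : 0 ≤ C' ^ q := Real.rpow_nonneg (hC.trans hCC'.le) q
  -- K controls the growth from above; the majorant property bounds the function below by -C'^q
  -- ‖z‖^q.
  refine ⟨?_, ⟨K + C' ^ q, by positivity, fun z => ?_⟩, hmaj, fun z => ?_, fun c hc z => ?_⟩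
  · exact (lowerSemicontinuous_bellman hq0 hbdd).measurable.comp (by fun_prop)
  · have h1 : bellman q C' (fun n => m (latticeVec e n)) ((z.1 : ℂ), (z.2 : ℂ)) ≤ K * ‖z‖ ^ q := by
      refine ciSup_le fun w => (hK w.1 w.2 _).trans (le_of_eq ?_)
      simp [Prod.norm_def]
    have h2 := hmaj z
    have h3 : |z.1| ^ q ≤ ‖z‖ ^ q :=
      Real.rpow_le_rpow (abs_nonneg _) (norm_fst_le z) hq0
    have h4 : 0 ≤ |z.2| ^ q := by positivity
    have h5 : C' ^ q * |z.1| ^ q ≤ C' ^ q * ‖z‖ ^ q := by gcongr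
    have h6 : 0 ≤ K * ‖z‖ ^ q := by positivity
    have h7 : 0 ≤ C' ^ q * ‖z‖ ^ q := by positivity
    rw [abs_le, add_mul]
    constructor <;> linarith
  · have := bellman_neg (q := q) (C := C') (σ := fun n => m (latticeVec e n))
      ((z.1 : ℂ), (z.2 : ℂ))
    simpa using this
  · have h := concaveOn_bellman hq0
      (fun n hn l => tendsto_symbol_add_zsmul e hcont hhom hn l)
      (fun n hn j hj => symbol_zsmul e heven hhom hn hj) hbdd
      (mem_closure_symbol e hcont hhom hc) ((z.1 : ℂ), (z.2 : ℂ))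
    simpa using h

end Symbol

/-! ### Conclusion -/

theorem transformConst_le_multiplierNorm {d : ℕ} [Nonempty (Fin d)] {p : ℝ≥0∞} (hp1 : 1 < p)
    (hp : p ≠ ∞) {m : EuclideanSpace ℝ (Fin d) → ℝ}
    (hm : IsFourierMultiplier (fun ξ => (m ξ : ℂ)))
    (hcont : ContinuousOn m {0}ᶜ)
    (heven : ∀ ξ, ξ ≠ 0 → m (-ξ) = m ξ)
    (hhom : ∀ ξ, ξ ≠ 0 → ∀ t : ℝ, 0 < t → m (t • ξ) = m ξ)
    (e : OrthonormalBasis (Fin d) ℝ (EuclideanSpace ℝ (Fin d))) :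
    transformConst p (⨅ j : Fin d, m (e j)) (⨆ j : Fin d, m (e j))
      ≤ multiplierNorm p (fun ξ => (m ξ : ℂ)) hm := by
  obtain ⟨q, hq, rfl⟩ : ∃ q : ℝ, 1 < q ∧ p = ENNReal.ofReal q := by
    refine ⟨p.toReal, ?_, (ENNReal.ofReal_toReal hp).symm⟩
    rw [← ENNReal.toReal_one]
    exact (ENNReal.toReal_lt_toReal ENNReal.one_ne_top hp).2 hp1
  -- The extra ε provides both the strict gap needed for the growth of the Bellman function and a
  -- positive constant even when C = 0.
  refine le_sInf fun C hC => ENNReal.le_of_forall_pos_le_add fun ε hε hCt => ?_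
  have hC' : ENNReal.ofReal C.toReal = C := ENNReal.ofReal_toReal hCt.ne
  have hε' : C + ε = ENNReal.ofReal (C.toReal + ε) := by
    rw [ENNReal.ofReal_add ENNReal.toReal_nonneg ε.coe_nonneg, hC', ENNReal.ofReal_coe_nnreal]
  rw [hε']
  refine sInf_le ?_
  have hε0 : (0 : ℝ) < ε := by exact_mod_cast hε
  refine (isBellmanFunction_bellman e hcont heven hhom hq ENNReal.toReal_nonneg
    (lt_add_of_pos_right C.toReal hε0) fun w hw => integral_rpow_symbolPairs_le e hm hcont hhom hq
    ENNReal.toReal_nonneg (fun f hf => ?_) hw).isTransformBound hq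
    (add_pos_of_nonneg_of_pos ENNReal.toReal_nonneg hε0)
  rw [hC']
  exact hC f hf

theorem theorem1p3 (d : ℕ) (hd : 2 ≤ d) (p : ℝ≥0∞) (hp1 : 1 < p) (hp : p ≠ ∞)
    (m : EuclideanSpace ℝ (Fin d) → ℝ)
    (hm : IsFourierMultiplier (fun ξ => (m ξ : ℂ)))
    (hcont : ContinuousOn m {0}ᶜ)
    (heven : ∀ ξ, ξ ≠ 0 → m (-ξ) = m ξ)
    (hhom : ∀ ξ, ξ ≠ 0 → ∀ t : ℝ, 0 < t → m (t • ξ) = m ξ) :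
    transformConst p (⨅ j : Fin d, m (EuclideanSpace.single j 1))
        (⨆ j : Fin d, m (EuclideanSpace.single j 1))
      ≤ multiplierNorm p (fun ξ => (m ξ : ℂ)) hm ∧
    (⨆ e : OrthonormalBasis (Fin d) ℝ (EuclideanSpace ℝ (Fin d)),
        transformConst p (⨅ j : Fin d, m (e j)) (⨆ j : Fin d, m (e j)))
      ≤ multiplierNorm p (fun ξ => (m ξ : ℂ)) hm := by
  have : Nonempty (Fin d) := ⟨⟨0, by omega⟩⟩
  refine ⟨?_, iSup_le fun e => transformConst_le_multiplierNorm hp1 hp hm hcont heven hhom e⟩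
  simpa using transformConst_le_multiplierNorm hp1 hp hm hcont heven hhom
    (EuclideanSpace.basisFun (Fin d) ℝ)
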